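/- Let $V$ be a set of program variables, each with a nonempty type and all of them classical (there are no quantum variables), and let $V_1,V_2$ be two disjoint tagged copies of $V$. Write $\mathrm{Types}[W]$ for the set of assignments of values to the variables in $W$, identify $\mathrm{Types}[V_i]$ with $\mathrm{Types}[V]$ and write $m_1m_2\in\mathrm{Types}[V_1V_2]$ for the union of $m_1\in \mathrm{Types}[V_1]$, $m_2\in \mathrm{Types}[V_2]$. Let $c_1,c_2$ be classical programs over $V$, i.e. built from skip, assignments $x\leftarrow e$, samplings from discrete subprobability distributions, conditionals, while loops and sequential composition, where an expression is a function of the memory that depends on finitely many variables. Let $[\![c]\!]_{\mathrm{class}}$ be the classical denotational semantics of $c$ (a map on absolutely summable functions on memories), and $[\![c]\!]$ its quantum semantics (a map on cq-operators). Let $a,b$ be boolean expressions over $V_1V_2$, and let $\mathrm{Cla}[a]$ be the quantum predicate that assigns to a classical memory the whole space $\ell^2$ of the (here empty) set of quantum variables if $a$ is true there, and the subspace $0$ otherwise. A cq-operator is a trace-class operator $\rho=\sum_m |m\rangle\langle m|\otimes\rho_m$ with trace-class $\rho_m$, where $m$ ranges over the assignments to the classical variables; a cq-state is a positive (not necessarily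 normalized) cq-operator; it satisfies a predicate $A$ iff the support of $\rho_m$ is contained in $A_m$ for all $m$; an operator on $\ell^2(\mathrm{Types}[V_1V_2])$ is separable iff it is a sum $\sum_i\sigma_i\otimes\tau_i$ with positive trace-class $\sigma_i,\tau_i$ over $V_1$ and $V_2$. A cq-superoperator is a completely positive linear map $\mathcal E$ on cq-operators with $\operatorname{tr}\mathcal E(\rho)\le\operatorname{tr}\rho$ for all positive $\rho$. The classical semantics is linear (with infinite sums), and $[\![\mathrm{skip}]\!]_{\mathrm{class}}(\mu)=\mu$, $[\![x\leftarrow e]\!]_{\mathrm{class}}(\delta_m)=\delta_{m(x:=e(m))}$, sampling maps $\delta_m$ to $\sum_z e(m)(z)\,\delta_{m(x:=z)}$, $[\![\mathrm{if}\ e\ \mathrm{then}\ c\ \mathrm{else}\ d]\!]_{\mathrm{class}}(\mu)=[\![c]\!]_{\mathrm{class}}(\mu{\downarrow}e)+[\![d]\!]_{\mathrm{class}}(\mu{\downarrow}\lnot e)$, $[\![\mathrm{while}\ e\ c]\!]_{\mathrm{class}}(\mu)=\sum_{i\ge0}F^i(\mu){\downarrow}\lnot e$ with $F(\nu)=[\![c]\!]_{\mathrm{class}}(\nu{\downarrow}e)$,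 and $[\![c;d]\!]_{\mathrm{class}}=[\![d]\!]_{\mathrm{class}}\circ[\![c]\!]_{\mathrm{class}}$, where $\mu{\downarrow}e$ is $\mu$ restricted to the memories on which $e$ is true. The quantum semantics on cq-operators is defined by the same rules, with $|m\rangle\langle m|\otimes\rho_m$ in place of $\delta_m$ (so $x\leftarrow e$ maps it to $|m(x:=e(m))\rangle\langle m(x:=e(m))|\otimes\rho_m$, and so on). Then the following four statements are equivalent. (i) (pRHL) For all $m_1\in\mathrm{Types}[V_1]$, $m_2\in\mathrm{Types}[V_2]$ such that $a$ holds on $m_1m_2$, there is a subprobability distribution $\mu'$ on $\mathrm{Types}[V_1V_2]$ with first marginal $[\![c_1]\!]_{\mathrm{class}}(\delta_{m_1})$ and second marginal $[\![c_2]\!]_{\mathrm{class}}(\delta_{m_2})$ such that $b$ holds on every memory in the support of $\mu'$. (ii) (qRHL) For every separable cq-state $\rho$ over $V_1V_2$ that satisfies $\mathrm{Cla}[a]$ there is a separable cq-state $\rho'$ over $V_1V_2$ that satisfies $\mathrm{Cla}[b]$ with $\operatorname{tr}_{V_2}\rho'=[\![c_1]\!](\operatorname{tr}_{V_2}\rho)$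 and $\operatorname{tr}_{V_1}\rho'=[\![c_2]\!](\operatorname{tr}_{V_1}\rho)$. (iii) (non-separable variant) For every cq-state $\rho$ over $V_1V_2$ that satisfies $\mathrm{Cla}[a]$ there is a cq-state $\rho'$ over $V_1V_2$ that satisfies $\mathrm{Cla}[b]$ with $\operatorname{tr}_{V_2}\rho'=[\![c_1]\!](\operatorname{tr}_{V_2}\rho)$ and $\operatorname{tr}_{V_1}\rho'=[\![c_2]\!](\operatorname{tr}_{V_1}\rho)$. (iv) (uniform variant) There is a cq-superoperator $\mathcal E$ on $V_1V_2$ such that for every cq-state $\rho$ over $V_1V_2$ that satisfies $\mathrm{Cla}[a]$, the state $\rho':=\mathcal E(\rho)$ satisfies $\mathrm{Cla}[b]$, $\operatorname{tr}_{V_2}\rho'=[\![c_1]\!](\operatorname{tr}_{V_2}\rho)$ and $\operatorname{tr}_{V_1}\rho'=[\![c_2]\!](\operatorname{tr}_{V_1}\rho)$. -/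

import Mathlib

open scoped NNReal ENNReal ComplexOrder ComplexConjugate

universe u v w

noncomputable section

namespace QRHL

/-! ## Hilbert spaces `ℓ²(X)` and operators on them -/

section HilbertSpaces

variable {X Y Z : Type*}

/-- The Hilbert space `ℓ²(X)` of square-summable functions `X → ℂ`, for an arbitrary set `X`. -/
abbrev L2 (X : Type*) : Type _ := lp (fun _ : X => ℂ) 2

/-- Bounded operators on `ℓ²(X)`. -/
abbrev Op (X : Type*) : Type _ := L2 X →L[ℂ] L2 X

open Classical in
/-- The computational basis vector `|x⟩`. -/
def ket (x : X) : L2 X := lp.single 2 x (1 : ℂ)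

theorem summable_sq (ψ : L2 X) : Summable fun x => ‖ψ x‖ ^ (2 : ℝ) := by
  have h := (lp.memℓp ψ).summable (by norm_num)
  simpa using h

theorem tsum_sq (ψ : L2 X) : ∑' x, ‖ψ x‖ ^ (2 : ℝ) = ‖ψ‖ ^ (2 : ℝ) := by
  have h := lp.norm_rpow_eq_tsum (p := 2) (by norm_num) ψ
  simpa using h.symm

theorem memL2_of_summable {ψ : X → ℂ} (h : Summable fun x => ‖ψ x‖ ^ (2 : ℝ)) :
    Memℓp ψ 2 :=
  memℓp_gen (by simpa using h)

theorem norm_le_of_tsum {ψ : L2 X} {C : ℝ} (hC : 0 ≤ C)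
    (h : ∑' x, ‖ψ x‖ ^ (2 : ℝ) ≤ C ^ (2 : ℝ)) : ‖ψ‖ ≤ C :=
  lp.norm_le_of_tsum_le (by norm_num) hC (by simpa using h)

/-- Restriction `ℓ²(Y) → ℓ²(X)`, `φ ↦ φ ∘ f`, along an injection `f : X → Y`. Its adjoint is the
isometry `ℓ²(X) → ℓ²(Y)` mapping `|x⟩` to `|f x⟩`. -/
def restr (f : X ↪ Y) : L2 Y →L[ℂ] L2 X :=
  LinearMap.mkContinuous
    { toFun := fun φ => ⟨fun x => φ (f x),
        memL2_of_summable ((summable_sq φ).comp_injective f.injective)⟩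
      map_add' := fun _ _ => rfl
      map_smul' := fun _ _ => rfl } 1 (by
    intro φ
    rw [one_mul]
    refine norm_le_of_tsum (norm_nonneg φ) ?_
    rw [← tsum_sq φ]
    exact tsum_comp_le_tsum_of_inj (summable_sq φ)
      (fun y => Real.rpow_nonneg (norm_nonneg _) _) f.injective)

@[simp] theorem restr_apply (f : X ↪ Y) (φ : L2 Y) (x : X) : restr f φ x = φ (f x) := rfl

/-- The injection `x ↦ (x, y)` under an identification `Z ≃ X × Y`. -/
def fiber (s : Z ≃ X × Y) (y : Y) : X ↪ Z :=
  ⟨fun x => s.symm (x, y), fun x x' h => by simpa using h⟩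

theorem sum_fibers (s : Z ≃ X × Y) (f g : Y → X → ℝ) (hf : ∀ y x, 0 ≤ f y x)
    (hg : ∀ y x, 0 ≤ g y x) (C : ℝ) (hfs : ∀ y, Summable (f y))
    (hgs : Summable fun z => g (s z).2 (s z).1) (hle : ∀ y, ∑' x, f y x ≤ C * ∑' x, g y x) :
    Summable (fun z => f (s z).2 (s z).1) ∧
      ∑' z, f (s z).2 (s z).1 ≤ C * ∑' z, g (s z).2 (s z).1 := by
  let e : Z ≃ Y × X := s.trans (Equiv.prodComm X Y)
  have hG : Summable fun p : Y × X => g p.1 p.2 :=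
    (e.summable_iff (f := fun p : Y × X => g p.1 p.2)).1 hgs
  have hG' := (summable_prod_of_nonneg (f := fun p : Y × X => g p.1 p.2)
    (fun p => hg p.1 p.2)).1 hG
  have hs2 : Summable fun y => ∑' x, f y x :=
    Summable.of_nonneg_of_le (fun y => tsum_nonneg (hf y)) hle (hG'.2.mul_left C)
  have hF : Summable fun p : Y × X => f p.1 p.2 :=
    (summable_prod_of_nonneg (f := fun p : Y × X => f p.1 p.2)
      (fun p => hf p.1 p.2)).2 ⟨hfs, hs2⟩
  refine ⟨(e.summable_iff (f := fun p : Y × X => f p.1 p.2)).2 hF, ?_⟩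
  have h1 : ∑' z, f (s z).2 (s z).1 = ∑' p : Y × X, f p.1 p.2 :=
    e.tsum_eq (fun p : Y × X => f p.1 p.2)
  have h2 : ∑' z, g (s z).2 (s z).1 = ∑' p : Y × X, g p.1 p.2 :=
    e.tsum_eq (fun p : Y × X => g p.1 p.2)
  rw [h1, h2, hF.tsum_prod, hG.tsum_prod, ← tsum_mul_left]
  exact Summable.tsum_le_tsum hle hs2 (hG'.2.mul_left C)

theorem summable_ampl (s : Z ≃ X × Y) (A : Op X) (ψ : L2 Z) :
    Summable (fun z => ‖A (restr (fiber s (s z).2) ψ) (s z).1‖ ^ (2 : ℝ)) ∧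
    ∑' z, ‖A (restr (fiber s (s z).2) ψ) (s z).1‖ ^ (2 : ℝ) ≤ (‖A‖ * ‖ψ‖) ^ (2 : ℝ) := by
  have hg : (fun z => ‖restr (fiber s (s z).2) ψ (s z).1‖ ^ (2 : ℝ)) =
      fun z => ‖ψ z‖ ^ (2 : ℝ) := by
    funext z
    have hz : fiber s (s z).2 (s z).1 = z := s.symm_apply_apply z
    rw [restr_apply, hz]
  have key := sum_fibers s (fun y x => ‖A (restr (fiber s y) ψ) x‖ ^ (2 : ℝ))
    (fun y x => ‖restr (fiber s y) ψ x‖ ^ (2 : ℝ))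
    (fun _ _ => Real.rpow_nonneg (norm_nonneg _) _)
    (fun _ _ => Real.rpow_nonneg (norm_nonneg _) _) (‖A‖ ^ (2 : ℝ))
    (fun y => summable_sq _) (by rw [hg]; exact summable_sq ψ) (by
      intro y
      rw [tsum_sq, tsum_sq, ← Real.mul_rpow (norm_nonneg _) (norm_nonneg _)]
      exact Real.rpow_le_rpow (norm_nonneg _) (A.le_opNorm _) (by norm_num))
  rw [hg, tsum_sq, ← Real.mul_rpow (norm_nonneg _) (norm_nonneg _)] at key
  exact key

/-- The operator `A ⊗ id` on `ℓ²(Z)`, where `A` is an operator on `ℓ²(X)` and `Z ≃ X × Y`. -/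
def ampl (s : Z ≃ X × Y) (A : Op X) : Op Z :=
  LinearMap.mkContinuous
    { toFun := fun ψ => ⟨fun z => A (restr (fiber s (s z).2) ψ) (s z).1,
        memL2_of_summable (summable_ampl s A ψ).1⟩
      map_add' := fun ψ φ => by ext z; simp; rfl
      map_smul' := fun c ψ => by ext z; simp } ‖A‖ (by
    intro ψ
    exact norm_le_of_tsum (by positivity) (summable_ampl s A ψ).2)

/-- The tensor product `A ⊗ B` as an operator on `ℓ²(Z)`, where `Z ≃ X × Y`. -/
def tensorOp (s : Z ≃ X × Y) (A : Op X) (B : Op Y) : Op Z :=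
  ampl s A ∘L ampl (s.trans (Equiv.prodComm X Y)) B

/-- The rank-one operator `|ψ⟩⟨φ|`. -/
def ketBra (ψ φ : L2 X) : Op X := (innerSL ℂ φ).smulRight ψ

/-- The trace `∑ₓ ⟨x|A|x⟩`. -/
def tr (A : Op X) : ℂ := ∑' x, inner ℂ (ket x) (A (ket x))

/-- The positive trace-class operators: positive operators whose trace
`∑ₓ ⟨x|A|x⟩` exists. -/
def TracePos (A : Op X) : Prop :=
  A.IsPositive ∧ Summable fun x => inner ℂ (ket x) (A (ket x))

/-- The space of trace-class operators on `ℓ²(X)`: the linear span of the positive operators with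
finite trace. -/
def TraceClass (X : Type*) : Submodule ℂ (Op X) := Submodule.span ℂ {A | TracePos A}

/-- `ρ = ∑ᵢ fᵢ` for a (possibly uncountable) family of positive operators: `ρ` is the least upper
bound of the finite partial sums, with respect to `A ≤ B` iff `B - A` is positive. -/
def IsPosSum {ι : Type*} (f : ι → Op X) (ρ : Op X) : Prop :=
  (∀ J : Finset ι, (ρ - ∑ i ∈ J, f i).IsPositive) ∧
  ∀ σ : Op X, (∀ J : Finset ι, (σ - ∑ i ∈ J, f i).IsPositive) → (σ - ρ).IsPositive

/-- The support of `ρ`: the image of the smallest projector `P` with `P ρ P = ρ`. -/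
def suppo (ρ : Op X) : Submodule ℂ (L2 X) :=
  sInf {S | ∃ P : Op X, IsStarProjection P ∧ P ∘L ρ ∘L P = ρ ∧ S = LinearMap.range P.toLinearMap}

end HilbertSpaces

/-! ## Variables, memories, distributions, expressions -/

/-- A set `V` of program variables: classical variables `Cl`, quantum variables `Qu`, and the
nonempty type of each of them. -/
structure VarSet where
  Cl : Type u
  Qu : Type u
  clTy : Cl → Type v
  quTy : Qu → Type v
  clTy_nonempty : ∀ x, Nonempty (clTy x)
  quTy_nonempty : ∀ q, Nonempty (quTy q)

namespace VarSet

/-- The assignments of values to the classical variables. -/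
abbrev ClMem (V : VarSet.{u, v}) : Type (max u v) := ∀ x : V.Cl, V.clTy x

/-- The assignments of values to the quantum variables
(labels of the computational basis of the quantum memory). -/
abbrev QuMem (V : VarSet.{u, v}) : Type (max u v) := ∀ q : V.Qu, V.quTy q

/-- The assignments of values to all variables, split into classical and quantum part. -/
abbrev Mem (V : VarSet.{u, v}) : Type (max u v) := V.ClMem × V.QuMem

/-- The disjoint union `V W` of two sets of variables. In particular `V.union V` is the set
`V₁ V₂` of two tagged copies of `V`: the variable `x` becomes `x₁ = inl x` and `x₂ = inr x`. -/
def union (V W : VarSet.{u, v}) : VarSet.{u, v} where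
  Cl := V.Cl ⊕ W.Cl
  Qu := V.Qu ⊕ W.Qu
  clTy := Sum.elim V.clTy W.clTy
  quTy := Sum.elim V.quTy W.quTy
  clTy_nonempty := by rintro (x | x); exacts [V.clTy_nonempty x, W.clTy_nonempty x]
  quTy_nonempty := by rintro (x | x); exacts [V.quTy_nonempty x, W.quTy_nonempty x]

variable {V W : VarSet.{u, v}}

/-- A classical memory of `V W` is a pair of classical memories. -/
def clSplit (V W : VarSet.{u, v}) : (V.union W).ClMem ≃ V.ClMem × W.ClMem :=
  Equiv.sumPiEquivProdPi (Sum.elim V.clTy W.clTy)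

/-- The same for the labels of quantum memories. -/
def quSplit (V W : VarSet.{u, v}) : (V.union W).QuMem ≃ V.QuMem × W.QuMem :=
  Equiv.sumPiEquivProdPi (Sum.elim V.quTy W.quTy)

/-- The same for full memories. -/
def memSplit (V W : VarSet.{u, v}) : (V.union W).Mem ≃ V.Mem × W.Mem :=
  (Equiv.prodCongr (clSplit V W) (quSplit V W)).trans (Equiv.prodProdProdComm _ _ _ _)

/-- The union `m₁ m₂` of classical memories of `V` and `W`. -/
def clUnion (m₁ : V.ClMem) (m₂ : W.ClMem) : (V.union W).ClMem := (clSplit V W).symm (m₁, m₂)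

end VarSet

/-- Subprobability distributions on the set `X`. -/
structure SubDistr (X : Type*) where
  prob : X → ℝ≥0
  sum_le_one : ∑' x, (prob x : ℝ≥0∞) ≤ 1

/-- The support of a distribution. -/
def SubDistr.supp {X : Type*} (μ : SubDistr X) : Set X := {x | 0 < μ.prob x}

/-- An expression with values in `T`: a finite set of free classical variables, and a function of
the classical memory that depends only on these variables. -/
structure Expr (V : VarSet.{u, v}) (T : Type w) where
  fv : Finset V.Cl
  eval : V.ClMem → T
  eval_congr : ∀ m m' : V.ClMem, (∀ x ∈ fv, m x = m' x) → eval m = eval m'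

/-- Postcomposition of an expression with a function. -/
def Expr.map {V : VarSet.{u, v}} {T S : Type*} (f : T → S) (e : Expr V T) : Expr V S where
  fv := e.fv
  eval := fun m => f (e.eval m)
  eval_congr := fun m m' h => congrArg f (e.eval_congr m m' h)

/-! ## Programs -/

/-- A list of `n` distinct quantum variables. -/
abbrev QuList (V : VarSet.{u, v}) (n : ℕ) : Type u := Fin n ↪ V.Qu

/-- The tuples of values of the variables in the list `Q`. -/
abbrev QuList.Ty {V : VarSet.{u, v}} {n : ℕ} (Q : QuList V n) : Type v := ∀ i, V.quTy (Q i)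

/-- Projective measurements on `ℓ²(E)` with outcomes in `D`. -/
structure Meas (D E : Type*) where
  proj : D → Op E
  isProj : ∀ z, IsStarProjection (proj z)
  sum_le : ∀ F : Finset D, ((1 : Op E) - ∑ z ∈ F, proj z).IsPositive

/-- Well-typed programs with variables in `V`. -/
inductive Prog (V : VarSet.{u, v}) : Type (max u v)
  | skip : Prog V
  | assign (x : V.Cl) (e : Expr V (V.clTy x)) : Prog V
  | sample (x : V.Cl) (e : Expr V (SubDistr (V.clTy x))) : Prog V
  | ite (e : Expr V Bool) (c d : Prog V) : Prog V
  | while (e : Expr V Bool) (c : Prog V) : Prog V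
  | seq (c d : Prog V) : Prog V
  | qinit {n : ℕ} (Q : QuList V n) (e : Expr V {ψ : L2 Q.Ty // ‖ψ‖ = 1}) : Prog V
  | qapply {n : ℕ} (Q : QuList V n) (e : Expr V (L2 Q.Ty →ₗᵢ[ℂ] L2 Q.Ty)) : Prog V
  | qmeasure {n : ℕ} (x : V.Cl) (Q : QuList V n) (e : Expr V (Meas (V.clTy x) Q.Ty)) : Prog V

/-- A program is classical if it contains no quantum initialization, application, measurement. -/
def Prog.IsClassical {V : VarSet.{u, v}} : Prog V → Prop
  | .skip => True
  | .assign _ _ => True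
  | .sample _ _ => True
  | .ite _ c d => c.IsClassical ∧ d.IsClassical
  | .while _ c => c.IsClassical
  | .seq c d => c.IsClassical ∧ d.IsClassical
  | .qinit _ _ => False
  | .qapply _ _ => False
  | .qmeasure _ _ _ => False

section Semantics

variable {V W : VarSet.{u, v}}

open Classical in
/-- Update of a classical memory. -/
def upd (m : V.ClMem) (x : V.Cl) (z : V.clTy x) : V.ClMem := Function.update m x z

/-! ## Classical semantics -/

open Classical in
/-- The point distribution at `m`. -/
def pointDistr {X : Type*} (m : X) : X → ℝ := fun m' => if m' = m then 1 else 0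

/-- Restriction of a real-valued function on memories to the memories satisfying `p`. -/
def restrictCl (p : V.ClMem → Bool) (μ : V.ClMem → ℝ) : V.ClMem → ℝ :=
  fun m => if p m then μ m else 0

/-- The classical semantics of a classical program, mapping absolutely summable functions on
memories to such functions; it is given on point distributions and extended to
`μ = ∑ₘ μ(m) δₘ`. -/
def denotCl : (c : Prog V) → c.IsClassical → (V.ClMem → ℝ) → (V.ClMem → ℝ)
  | .skip, _ => fun μ => μ
  | .assign x e, _ => fun μ m' => ∑' m, μ m * pointDistr (upd m x (e.eval m)) m'
  | .sample x e, _ => fun μ m' =>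
      ∑' m, μ m * ∑' z, ((e.eval m).prob z : ℝ) * pointDistr (upd m x z) m'
  | .ite e c d, h => fun μ m =>
      denotCl c h.1 (restrictCl e.eval μ) m + denotCl d h.2 (restrictCl (fun m => !e.eval m) μ) m
  | .while e c, h => fun μ m =>
      ∑' i : ℕ, restrictCl (fun m => !e.eval m)
        ((fun ν => denotCl c h (restrictCl e.eval ν))^[i] μ) m
  | .seq c d, h => fun μ => denotCl d h.2 (denotCl c h.1 μ)
  | .qinit _ _, h => h.elim
  | .qapply _ _, h => h.elim
  | .qmeasure _ _ _, h => h.elim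

/-! ## Classical-quantum operators -/

/-- The injection `q ↦ (m, q)` of labels of quantum memories into memories. -/
def atMem (m : V.ClMem) : V.QuMem ↪ V.Mem := ⟨fun q => (m, q), fun _ _ h => (Prod.mk.inj h).2⟩

/-- The operator `|m⟩⟨m| ⊗ A` on `ℓ²(V)`, for an operator `A` on the quantum memory. -/
def point (m : V.ClMem) (A : Op V.QuMem) : Op V.Mem :=
  (restr (atMem m)).adjoint ∘L A ∘L restr (atMem m)

/-- The block `ρₘ` of `ρ` at the classical memory `m`: if `ρ = ∑ₘ |m⟩⟨m| ⊗ ρₘ`, this is `ρₘ`. -/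
def block (ρ : Op V.Mem) (m : V.ClMem) : Op V.QuMem :=
  restr (atMem m) ∘L ρ ∘L (restr (atMem m)).adjoint

/-- The space of cq-operators: trace-class operators of the form `∑ₘ |m⟩⟨m| ⊗ ρₘ` with
trace-class `ρₘ`. -/
def CQ (V : VarSet.{u, v}) : Submodule ℂ (Op V.Mem) where
  carrier := {ρ | ρ ∈ TraceClass V.Mem ∧ ∃ r : V.ClMem → Op V.QuMem,
    (∀ m, r m ∈ TraceClass V.QuMem) ∧ HasSum (fun m => point m (r m)) ρ}
  zero_mem' := ⟨zero_mem _, fun _ => 0, fun _ => zero_mem _, by simp [point]⟩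
  add_mem' := by
    rintro ρ σ ⟨h, r, hr, hs⟩ ⟨h', r', hr', hs'⟩
    refine ⟨add_mem h h', fun m => r m + r' m, fun m => add_mem (hr m) (hr' m), ?_⟩
    simpa [point, ContinuousLinearMap.add_comp, ContinuousLinearMap.comp_add] using hs.add hs'
  smul_mem' := by
    rintro a ρ ⟨h, r, hr, hs⟩
    refine ⟨Submodule.smul_mem _ a h, fun m => a • r m,
      fun m => Submodule.smul_mem _ a (hr m), ?_⟩
    simpa [point, ContinuousLinearMap.smul_comp, ContinuousLinearMap.comp_smul]
      using hs.const_smul a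

/-- The positive cq-operators, i.e. the (unnormalized) cq-states. -/
def CQPos (ρ : Op V.Mem) : Prop := ρ ∈ CQ V ∧ TracePos ρ

/-- Positivity of an operator-valued matrix, as an operator on `ℓ²(X) ⊗ ℂⁿ`. -/
def MatrixPos {X : Type*} {n : ℕ} (R : Fin n → Fin n → Op X) : Prop :=
  ∀ ψ : Fin n → L2 X, 0 ≤ ∑ i, ∑ j, inner ℂ (ψ i) (R i j (ψ j))

/-- A cq-superoperator: a completely positive trace-decreasing linear map on cq-operators. -/
structure IsCQSuperop (E : CQ V →ₗ[ℂ] CQ W) : Prop where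
  completelyPositive : ∀ (n : ℕ) (R : Fin n → Fin n → CQ V),
    MatrixPos (fun i j => (R i j : Op V.Mem)) → MatrixPos (fun i j => (E (R i j) : Op W.Mem))
  traceDecreasing : ∀ ρ : CQ V, (ρ : Op V.Mem).IsPositive →
    tr (E ρ : Op W.Mem) ≤ tr (ρ : Op V.Mem)

/-- `(V, W)`-separability: `ρ = ∑ᵢ ρᵢ ⊗ ρᵢ'` with positive trace-class `ρᵢ`, `ρᵢ'`. -/
def Separable (ρ : Op (V.union W).Mem) : Prop :=
  ∃ (ι : Type (max u v)) (σ : ι → Op V.Mem) (τ : ι → Op W.Mem),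
    (∀ i, TracePos (σ i)) ∧ (∀ i, TracePos (τ i)) ∧
    IsPosSum (fun i => tensorOp (VarSet.memSplit V W) (σ i) (τ i)) ρ

/-- The partial trace keeping the first set of variables:
`∑_{m₂} (id ⊗ ⟨m₂|) ρ (id ⊗ |m₂⟩)`. -/
def ptrace₁ (ρ : Op (V.union W).Mem) : Op V.Mem :=
  ∑' m₂ : W.Mem, restr (fiber (VarSet.memSplit V W) m₂) ∘L ρ ∘L
    (restr (fiber (VarSet.memSplit V W) m₂)).adjoint

/-- The partial trace keeping the second set of variables. -/
def ptrace₂ (ρ : Op (V.union W).Mem) : Op W.Mem :=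
  ∑' m₁ : V.Mem,
    restr (fiber ((VarSet.memSplit V W).trans (Equiv.prodComm _ _)) m₁) ∘L ρ ∘L
      (restr (fiber ((VarSet.memSplit V W).trans (Equiv.prodComm _ _)) m₁)).adjoint

/-! ## Quantum semantics -/

open Classical in
/-- The labels of quantum memories, split into the values of the variables in the list `Q` and
those of the other quantum variables. -/
def listSplit {n : ℕ} (Q : QuList V n) :
    V.QuMem ≃ Q.Ty × (∀ q : {q // q ∉ Set.range Q}, V.quTy q) :=
  (Equiv.piEquivPiSubtypeProd (fun q => q ∈ Set.range Q) V.quTy).trans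
    (Equiv.prodCongr (Equiv.piCongrLeft (fun q : {q // q ∈ Set.range Q} => V.quTy q)
      (Equiv.ofInjective Q Q.injective)).symm (Equiv.refl _))

/-- The operator `A` applied to the quantum variables in the list `Q`. -/
def liftOp {n : ℕ} (Q : QuList V n) (A : Op Q.Ty) : Op V.QuMem := ampl (listSplit Q) A

/-- The cq-operator restricted to the classical memories satisfying `p`. -/
def restrictCQ (p : V.ClMem → Bool) (ρ : Op V.Mem) : Op V.Mem :=
  ∑' m, if p m then point m (block ρ m) else 0

/-- The quantum semantics of a program, as a map on cq-operators `ρ = ∑ₘ |m⟩⟨m| ⊗ ρₘ`.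
All infinite sums converge for trace-class `ρ`. In the case of the initialization of `Q` with `ψ`,
`∑ₜ (|ψ⟩⟨t| ⊗ id) ρₘ (|t⟩⟨ψ| ⊗ id)` is the tensor product of `|ψ⟩⟨ψ|` with the partial trace of
`ρₘ` over `Q`. -/
def denot : Prog V → Op V.Mem → Op V.Mem
  | .skip => fun ρ => ρ
  | .assign x e => fun ρ => ∑' m, point (upd m x (e.eval m)) (block ρ m)
  | .sample x e => fun ρ =>
      ∑' m, ∑' z, (((e.eval m).prob z : ℝ) : ℂ) • point (upd m x z) (block ρ m)
  | .ite e c d => fun ρ =>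
      denot c (restrictCQ e.eval ρ) + denot d (restrictCQ (fun m => !e.eval m) ρ)
  | .while e c => fun ρ =>
      ∑' i : ℕ, restrictCQ (fun m => !e.eval m) ((fun σ => denot c (restrictCQ e.eval σ))^[i] ρ)
  | .seq c d => fun ρ => denot d (denot c ρ)
  | .qinit Q e => fun ρ => ∑' m, point m
      (∑' t : Q.Ty, liftOp Q (ketBra (e.eval m).1 (ket t)) ∘L block ρ m ∘L
        liftOp Q (ketBra (ket t) (e.eval m).1))
  | .qapply Q e => fun ρ => ∑' m, point m
      (liftOp Q (e.eval m).toContinuousLinearMap ∘L block ρ m ∘L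
        (liftOp Q (e.eval m).toContinuousLinearMap).adjoint)
  | .qmeasure x Q e => fun ρ => ∑' m, ∑' z, point (upd m x z)
      (liftOp Q ((e.eval m).proj z) ∘L block ρ m ∘L liftOp Q ((e.eval m).proj z))

end Semantics

/-! ## Predicates and judgments -/

/-- A quantum predicate over `V`: an expression whose values are (closed) subspaces of the state
space of the quantum variables. -/
abbrev Predicate (V : VarSet.{u, v}) : Type _ := Expr V (ClosedSubmodule ℂ (L2 V.QuMem))

/-- The state `ρ = ∑ₘ |m⟩⟨m| ⊗ ρₘ` satisfies the predicate `A` if the support of each `ρₘ` lies in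
the subspace given by `A` at `m`. -/
def Satisfies {V : VarSet.{u, v}} (ρ : Op V.Mem) (A : Predicate V) : Prop :=
  ∀ m : V.ClMem, suppo (block ρ m) ≤ (A.eval m).toSubmodule

/-- The classical predicate `Cla[e]`: the whole space where `e` is true, and `0` elsewhere. -/
def Cla {V : VarSet.{u, v}} (e : Expr V Bool) : Predicate V :=
  e.map fun b => if b then ⊤ else ⊥

variable {V : VarSet.{u, v}}

/-- The qRHL judgment `{A} c₁ ~ c₂ {B}`. The two copies of `V` in `V.union V` are its left and right
summands, so the program `cᵢ` with its variables tagged by `i` acts on the `i`-th summand by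
`denot cᵢ`. -/
def qRHL (A : Predicate (V.union V)) (c₁ c₂ : Prog V) (B : Predicate (V.union V)) : Prop :=
  ∀ ρ : Op (V.union V).Mem, CQPos ρ → Separable ρ → Satisfies ρ A →
    ∃ ρ' : Op (V.union V).Mem, CQPos ρ' ∧ Separable ρ' ∧ Satisfies ρ' B ∧
      ptrace₁ ρ' = denot c₁ (ptrace₁ ρ) ∧ ptrace₂ ρ' = denot c₂ (ptrace₂ ρ)

/-- The non-separable variant of the qRHL judgment. -/
def qRHLFirst (A : Predicate (V.union V)) (c₁ c₂ : Prog V) (B : Predicate (V.union V)) : Prop :=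
  ∀ ρ : Op (V.union V).Mem, CQPos ρ → Satisfies ρ A →
    ∃ ρ' : Op (V.union V).Mem, CQPos ρ' ∧ Satisfies ρ' B ∧
      ptrace₁ ρ' = denot c₁ (ptrace₁ ρ) ∧ ptrace₂ ρ' = denot c₂ (ptrace₂ ρ)

/-- The uniform variant of the qRHL judgment, with a cq-superoperator `E` as witness. -/
def qRHLUniform (A : Predicate (V.union V)) (c₁ c₂ : Prog V) (B : Predicate (V.union V)) : Prop :=
  ∃ E : CQ (V.union V) →ₗ[ℂ] CQ (V.union V), IsCQSuperop E ∧
    ∀ ρ : CQ (V.union V), CQPos (ρ : Op (V.union V).Mem) → Satisfies (ρ : Op (V.union V).Mem) A →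
      Satisfies (E ρ : Op (V.union V).Mem) B ∧
      ptrace₁ (E ρ : Op (V.union V).Mem) = denot c₁ (ptrace₁ (ρ : Op (V.union V).Mem)) ∧
      ptrace₂ (E ρ : Op (V.union V).Mem) = denot c₂ (ptrace₂ (ρ : Op (V.union V).Mem))

/-- The judgment `{a} c₁ ~ c₂ {b}` of probabilistic relational Hoare logic, for classical programs
(with classical variables only): for initial memories satisfying `a`, the final distributions of
`c₁` and `c₂` are the marginals of a joint distribution supported on memories satisfying `b`. -/
def pRHL (a : Expr (V.union V) Bool) (c₁ c₂ : Prog V) (h₁ : c₁.IsClassical) (h₂ : c₂.IsClassical)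
    (b : Expr (V.union V) Bool) : Prop :=
  ∀ m₁ m₂ : V.ClMem, a.eval (VarSet.clUnion m₁ m₂) = true →
    ∃ μ : SubDistr (V.union V).ClMem,
      (∀ m, denotCl c₁ h₁ (pointDistr m₁) m = ∑' m', (μ.prob (VarSet.clUnion m m') : ℝ)) ∧
      (∀ m, denotCl c₂ h₂ (pointDistr m₂) m = ∑' m', (μ.prob (VarSet.clUnion m' m) : ℝ)) ∧
      ∀ m ∈ μ.supp, b.eval m = true

end QRHL

end

/-!
Without quantum variables `ℓ²(QuMem)` is one-dimensional, so a cq-operator is a diagonal operator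
`∑ₘ f(m) |m⟩⟨m|` with absolutely summable `f` (`diagOp_entry`), and a cq-state is one with `f ≥ 0`,
written `massOp f` for a mass function `f` with values in `[0, ∞]` and finite total mass
(`exists_massOp_of_mem_CQ`). Under this correspondence the partial traces are the marginals of `f`
(`ptrace₁_massOp`, `ptrace₂_massOp`), `Cla[b]` says that `f` vanishes where `b` is false
(`satisfies_massOp_iff`), and every cq-state over `V₁V₂` is separable (`separable_of_CQPos`), which
makes the separable and the non-separable judgment equivalent.

The classical and the quantum semantics of a classical program are compared with a third one,
`denotMass`, on `[0, ∞]`-valued mass functions. There all sums converge and may be exchanged, so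
that it is easily seen to be determined by its values on point masses (`denotMass_eq_tsum`) and not
to increase the total mass (`tsum_denotMass_le`). The latter gives the convergence of the sums in
the other two semantics, and both agree with `denotMass` (`denotCl_toReal`, `denot_massOp`).

If a qRHL judgment holds, then the output state for the input `|m₁m₂⟩⟨m₁m₂|` is `massOp μ` for a
coupling `μ` as required by pRHL (`exists_coupling`). Conversely, couplings `μₘ` for the initial
memories `m` satisfying `a` form a subprobability kernel, which acts on cq-operators as a completely
positive trace-decreasing map `|m⟩⟨m| ↦ massOp μₘ` (`isCQSuperop_kernelOp`). By linearity this map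
is a witness for the uniform judgment (`qRHLUniform_of_pRHL`).
-/

noncomputable section

namespace QRHL

/-! ### Basis vectors and operators on `ℓ²(X)` -/

section Kets

variable {X Y Z : Type*}

open Classical in
theorem ket_apply (x y : X) : (ket x : L2 X) y = if y = x then 1 else 0 := by
  by_cases h : y = x
  · subst h; simp [ket]
  · simp [ket, h]

@[simp] theorem inner_ket_left (x : X) (ψ : L2 X) : inner ℂ (ket x) ψ = ψ x := by
  simp [ket, lp.inner_single_left]

theorem inner_ket_right (x : X) (ψ : L2 X) : inner ℂ ψ (ket x) = conj (ψ x) := by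
  rw [← inner_conj_symm, inner_ket_left]

theorem norm_ket (x : X) : ‖(ket x : L2 X)‖ = 1 := by
  simp [ket, lp.norm_single]

theorem hasSum_ket (ψ : L2 X) : HasSum (fun x => ψ x • (ket x : L2 X)) ψ := by
  classical
  have h := lp.hasSum_single (p := 2) (by norm_num) ψ
  convert h using 2 with x
  ext y
  by_cases h : y = x
  · subst h; simp [ket]
  · simp [ket, h]

/-- A bounded operator on `ℓ²(X)` is determined by its values on the basis vectors. -/
theorem op_ext {F : Type*} [NormedAddCommGroup F] [NormedSpace ℂ F] {A B : L2 X →L[ℂ] F}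
    (h : ∀ x, A (ket x) = B (ket x)) : A = B := by
  ext1 ψ
  have hA := (hasSum_ket ψ).mapL A
  have hB := (hasSum_ket ψ).mapL B
  simp only [map_smul, h] at hA hB
  exact hA.unique hB

theorem adjoint_restr_ket (f : X ↪ Y) (x : X) :
    (restr f).adjoint (ket x) = ket (f x) := by
  refine ext_inner_left ℂ fun ψ => ?_
  rw [ContinuousLinearMap.adjoint_inner_right, inner_ket_right, inner_ket_right, restr_apply]

theorem restr_ket_apply (f : X ↪ Y) (x : X) : restr f (ket (f x)) = ket x := by
  ext y
  by_cases h : y = x <;> simp [ket_apply, h]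

theorem restr_ket_of_notMem (f : X ↪ Y) {y : Y} (h : ∀ x, f x ≠ y) : restr f (ket y) = 0 := by
  ext x
  simp [ket_apply, h x]

/-- If `|x⟩` is an eigenvector of `A`, then `|x, y⟩` is an eigenvector of `A ⊗ id` for the same
eigenvalue. -/
theorem ampl_ket (s : Z ≃ X × Y) (A : Op X) (z : Z) {c : ℂ}
    (h : A (ket (s z).1) = c • ket (s z).1) : ampl s A (ket z) = c • ket z := by
  ext w
  change A (restr (fiber s (s w).2) (ket z)) (s w).1 = c * (ket z : L2 Z) w
  by_cases hw : (s w).2 = (s z).2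
  · have hz : z = fiber s (s w).2 (s z).1 := by
      rw [hw]; exact (s.symm_apply_apply z).symm
    conv_lhs => rw [hz]
    rw [restr_ket_apply]
    rw [h]
    have hwz : w = z ↔ (s w).1 = (s z).1 := by
      rw [← s.apply_eq_iff_eq, Prod.ext_iff]; simp [hw]
    by_cases hx : (s w).1 = (s z).1
    · simp [ket_apply, hwz.2 hx]
    · simp [ket_apply, hx, mt hwz.1 hx]
  · have hne : w ≠ z := fun e => hw (by rw [e])
    rw [restr_ket_of_notMem]
    · simp [ket_apply, hne]
    · intro x hx
      apply hw
      rw [← hx]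
      exact (congrArg Prod.snd (s.apply_symm_apply (x, (s w).2))).symm

theorem isPositive_iff_inner (A : Op X) : A.IsPositive ↔ ∀ ψ, 0 ≤ inner ℂ ψ (A ψ) := by
  rw [ContinuousLinearMap.isPositive_iff_complex]
  constructor
  · intro h ψ
    have := h ψ
    rw [← inner_conj_symm, ← this.1, Complex.conj_ofReal]
    exact_mod_cast this.2
  · intro h ψ
    have h1 := h ψ
    rw [← inner_conj_symm, Complex.nonneg_iff] at h1
    rw [Complex.conj_re, Complex.conj_im] at h1
    refine ⟨Complex.ext (by simp) ?_, by simpa using h1.1⟩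
    rw [Complex.ofReal_im]
    linarith [h1.2]

/-- An upper bound of the partial sums is an upper bound of the sum, for sums converging in norm: a
norm convergent sum of positive operators is therefore the least upper bound of its partial sums. -/
theorem isPositive_sub_of_hasSum {ι : Type*} {f : ι → Op X} {ρ σ : Op X} (hf : HasSum f ρ)
    (h : ∀ J : Finset ι, (σ - ∑ i ∈ J, f i).IsPositive) : (σ - ρ).IsPositive := by
  rw [isPositive_iff_inner]
  intro ψ
  have hc : Continuous fun A : Op X => inner ℂ ψ ((σ - A) ψ) := by fun_prop
  exact ge_of_tendsto' ((hc.tendsto ρ).comp hf) fun J => (isPositive_iff_inner _).1 (h J) ψ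

end Kets

/-! ### Diagonal operators and cq-operators -/

section Diagonal

variable {V : VarSet.{u, v}} [IsEmpty V.Qu]

instance {W : VarSet.{u, v}} [IsEmpty W.Qu] : IsEmpty (V.union W).Qu :=
  inferInstanceAs (IsEmpty (V.Qu ⊕ W.Qu))

/-- The basis label of a classical memory when there are no quantum variables. -/
def memOf (m : V.ClMem) : V.Mem := (m, default)

theorem eq_memOf (z : V.Mem) : z = memOf z.1 := Prod.ext rfl (Subsingleton.elim _ _)

@[simp] theorem memOf_fst (m : V.ClMem) : (memOf m).1 = m := rfl

theorem memOf_injective : Function.Injective (memOf (V := V)) :=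
  fun _ _ h => congrArg Prod.fst h

/-- Without quantum variables, classical memories label the computational basis. -/
def memEquiv : V.ClMem ≃ V.Mem where
  toFun := memOf
  invFun := Prod.fst
  left_inv _ := rfl
  right_inv z := (eq_memOf z).symm

/-- The projection `|m⟩⟨m|`. -/
def cproj (m : V.ClMem) : Op V.Mem := ketBra (ket (memOf m)) (ket (memOf m))

/-- The diagonal entry `⟨m|ρ|m⟩`, as a continuous linear functional of `ρ`. -/
def entry (m : V.ClMem) : Op V.Mem →L[ℂ] ℂ :=
  (innerSL ℂ (ket (memOf m))) ∘L ContinuousLinearMap.apply ℂ (L2 V.Mem) (ket (memOf m))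

theorem entry_eq (m : V.ClMem) (ρ : Op V.Mem) :
    entry m ρ = inner ℂ (ket (memOf m)) (ρ (ket (memOf m))) := rfl

theorem cproj_apply (m : V.ClMem) (ψ : L2 V.Mem) :
    cproj m ψ = ψ (memOf m) • ket (memOf m) := by
  simp [cproj, ketBra]

theorem norm_cproj_le (m : V.ClMem) : ‖cproj m‖ ≤ 1 := by
  refine ContinuousLinearMap.opNorm_le_bound _ zero_le_one fun ψ => ?_
  rw [cproj_apply, norm_smul, norm_ket, mul_one, one_mul]
  exact lp.norm_apply_le_norm (by norm_num) ψ _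

open Classical in
theorem cproj_ket (m : V.ClMem) (z : V.Mem) :
    cproj m (ket z) = if z.1 = m then ket z else 0 := by
  rw [cproj_apply, ket_apply]
  by_cases h : z.1 = m
  · subst h; rw [← eq_memOf]; simp
  · have : memOf m ≠ z := fun e => h (by rw [← e]; rfl)
    simp [h, this]

open Classical in
theorem entry_cproj (m m' : V.ClMem) : entry m (cproj m') = if m = m' then 1 else 0 := by
  rw [entry_eq, cproj_ket, memOf_fst]
  by_cases h : m = m'
  · rw [if_pos h, if_pos h, inner_ket_left, ket_apply, if_pos rfl]
  · simp [h]

/-- As `ℓ²(QuMem)` is one-dimensional, `|m⟩⟨m| ⊗ A` is a multiple of `|m⟩⟨m|`. -/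
theorem point_eq (m : V.ClMem) (A : Op V.QuMem) :
    point m A = (A (ket default)) default • cproj m := by
  refine op_ext fun z => ?_
  obtain ⟨n, rfl⟩ : ∃ n, z = memOf n := ⟨_, eq_memOf z⟩
  change (restr (atMem m)).adjoint (A (restr (atMem m) (ket (memOf n)))) =
    (A (ket default)) default • cproj m (ket (memOf n))
  rw [cproj_ket, memOf_fst]
  by_cases h : n = m
  · subst h
    have e : memOf n = atMem n default := rfl
    have h1 : A (ket default) = (A (ket default)) default • ket default := by
      ext q
      rw [Subsingleton.elim q default]
      simp [ket_apply]
    rw [if_pos rfl, e, restr_ket_apply]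
    conv_lhs => rw [h1]
    rw [map_smul, adjoint_restr_ket]
  · rw [restr_ket_of_notMem, if_neg h]
    · simp
    · exact fun q hq => h (congrArg Prod.fst hq).symm

theorem block_ket (ρ : Op V.Mem) (m : V.ClMem) :
    block ρ m (ket default) default = entry m ρ := by
  change (restr (atMem m)) (ρ ((restr (atMem m)).adjoint (ket default))) default = _
  rw [adjoint_restr_ket, entry_eq, inner_ket_left]
  rfl

theorem block_eq (ρ : Op V.Mem) (m : V.ClMem) : block ρ m = entry m ρ • 1 := by
  refine op_ext fun q => ?_
  rw [Subsingleton.elim q default]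
  ext q'
  rw [Subsingleton.elim q' default, block_ket]
  simp [ket_apply]

theorem point_block (m n : V.ClMem) (ρ : Op V.Mem) :
    point n (block ρ m) = entry m ρ • cproj n := by
  rw [point_eq, block_ket]

/-- The diagonal operator `∑ₘ f(m) |m⟩⟨m|`, for an absolutely summable `f`. -/
def diagOp (f : V.ClMem → ℂ) : Op V.Mem := ∑' m, f m • cproj m

theorem summable_smul_cproj {ι : Type*} {f : ι → ℂ} (hf : Summable f) (g : ι → V.ClMem) :
    Summable fun i => f i • cproj (g i) := by
  refine Summable.of_norm_bounded hf.norm fun i => ?_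
  rw [norm_smul]
  exact mul_le_of_le_one_right (norm_nonneg _) (norm_cproj_le _)

theorem hasSum_diagOp {f : V.ClMem → ℂ} (hf : Summable f) :
    HasSum (fun m => f m • cproj m) (diagOp f) :=
  (summable_smul_cproj hf id).hasSum

theorem entry_of_hasSum {f : V.ClMem → ℂ} {ρ : Op V.Mem}
    (h : HasSum (fun m => f m • cproj m) ρ) (m : V.ClMem) : entry m ρ = f m := by
  have h1 := h.mapL (entry m)
  simp only [map_smul, entry_cproj] at h1
  classical
  refine h1.unique ?_
  convert hasSum_ite_eq m (f m) using 2 with n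
  by_cases e : m = n
  · subst e; simp
  · simp [e, Ne.symm e]

theorem entry_diagOp {f : V.ClMem → ℂ} (hf : Summable f) (m : V.ClMem) :
    entry m (diagOp f) = f m := entry_of_hasSum (hasSum_diagOp hf) m

theorem diagOp_ket {f : V.ClMem → ℂ} (hf : Summable f) (z : V.Mem) :
    diagOp f (ket z) = f z.1 • ket z := by
  have h := (hasSum_diagOp hf).mapL (ContinuousLinearMap.apply ℂ (L2 V.Mem) (ket z))
  classical
  refine h.unique ?_
  convert hasSum_ite_eq z.1 (f z.1 • (ket z : L2 V.Mem)) using 2 with m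
  by_cases e : m = z.1
  · subst e; simp [cproj_ket]
  · simp [cproj_ket, e, Ne.symm e]

theorem hasSum_inner_diagOp {f : V.ClMem → ℂ} (hf : Summable f) (ψ φ : L2 V.Mem) :
    HasSum (fun m => f m * (φ (memOf m) * conj (ψ (memOf m)))) (inner ℂ ψ (diagOp f φ)) := by
  have h := ((hasSum_diagOp hf).mapL (ContinuousLinearMap.apply ℂ (L2 V.Mem) φ)).mapL
    (innerSL ℂ ψ)
  have e : ∀ m, innerSL ℂ ψ (ContinuousLinearMap.apply ℂ (L2 V.Mem) φ (f m • cproj m)) =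
      f m * (φ (memOf m) * conj (ψ (memOf m))) := fun m => by
    simp [cproj_apply, inner_ket_right]
  simp only [e] at h
  exact h

theorem diagOp_isPositive {f : V.ClMem → ℂ} (hf : Summable f) (h0 : ∀ m, 0 ≤ f m) :
    (diagOp f).IsPositive := by
  rw [isPositive_iff_inner]
  intro ψ
  refine (hasSum_inner_diagOp hf ψ ψ).nonneg fun m => mul_nonneg (h0 m) ?_
  exact Complex.mul_conj _ ▸ (by exact_mod_cast Complex.normSq_nonneg _)

theorem hasSum_tr_diagOp {f : V.ClMem → ℂ} (hf : Summable f) :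
    HasSum (fun z : V.Mem => inner ℂ (ket z) (diagOp f (ket z))) (∑' m, f m) := by
  refine (memEquiv (V := V)).hasSum_iff.1 ?_
  convert hf.hasSum using 1
  exact funext fun m => entry_diagOp hf m

theorem tr_diagOp {f : V.ClMem → ℂ} (hf : Summable f) : tr (diagOp f) = ∑' m, f m :=
  (hasSum_tr_diagOp hf).tsum_eq

theorem tracePos_diagOp {f : V.ClMem → ℂ} (hf : Summable f) (h0 : ∀ m, 0 ≤ f m) :
    TracePos (diagOp f) :=
  ⟨diagOp_isPositive hf h0, (hasSum_tr_diagOp hf).summable⟩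

theorem diagOp_add {f g : V.ClMem → ℂ} (hf : Summable f) (hg : Summable g) :
    diagOp (fun m => f m + g m) = diagOp f + diagOp g := by
  have h := (hasSum_diagOp hf).add (hasSum_diagOp hg)
  simp only [← add_smul] at h
  exact h.tsum_eq

theorem diagOp_smul (c : ℂ) {f : V.ClMem → ℂ} (hf : Summable f) :
    diagOp (fun m => c * f m) = c • diagOp f := by
  have h := (hasSum_diagOp hf).const_smul c
  simp only [smul_smul] at h
  exact h.tsum_eq

/-- An absolutely summable `f` is a linear combination of four nonnegative ones: the positive and
negative parts of its real and imaginary parts. -/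
theorem diagOp_mem_traceClass {f : V.ClMem → ℂ} (hf : Summable f) :
    diagOp f ∈ TraceClass V.Mem := by
  have key : ∀ g : V.ClMem → ℝ, Summable g → diagOp (fun m => (g m : ℂ)) ∈ TraceClass V.Mem := by
    intro g hg
    have hp : Summable fun m => (((g m)⁺ : ℝ) : ℂ) :=
      Complex.ofRealCLM.summable (Summable.of_nonneg_of_le (fun m => posPart_nonneg _)
        (fun m => max_le (le_abs_self _) (abs_nonneg _))
        hg.norm)
    have hn : Summable fun m => (((g m)⁻ : ℝ) : ℂ) :=
      Complex.ofRealCLM.summable (Summable.of_nonneg_of_le (fun m => negPart_nonneg _)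
        (fun m => max_le (neg_le_abs _) (abs_nonneg _))
        hg.norm)
    have e : (fun m => (g m : ℂ)) =
        fun m => (((g m)⁺ : ℝ) : ℂ) + (-1 : ℂ) * (((g m)⁻ : ℝ) : ℂ) := by
      funext m
      have := posPart_sub_negPart (g m)
      rw [neg_one_mul, ← sub_eq_add_neg, ← Complex.ofReal_sub, this]
    rw [e, diagOp_add hp (hn.mul_left (-1 : ℂ)), diagOp_smul _ hn]
    refine add_mem (Submodule.subset_span (tracePos_diagOp hp fun m => ?_))
      (Submodule.smul_mem _ _ (Submodule.subset_span (tracePos_diagOp hn fun m => ?_)))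
    · exact_mod_cast posPart_nonneg _
    · exact_mod_cast negPart_nonneg _
  have e : f = fun m => ((f m).re : ℂ) + Complex.I * ((f m).im : ℂ) := by
    funext m
    rw [mul_comm, Complex.re_add_im]
  have hre := Complex.reCLM.summable hf
  have him := Complex.imCLM.summable hf
  have hre' : Summable fun m => ((f m).re : ℂ) := Complex.ofRealCLM.summable hre
  have him' : Summable fun m => ((f m).im : ℂ) := Complex.ofRealCLM.summable him
  rw [e, diagOp_add hre' (him'.mul_left Complex.I), diagOp_smul _ him']
  exact add_mem (key _ hre) (Submodule.smul_mem _ _ (key _ him))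

/-- A scalar, as an operator on the one-dimensional space `ℓ²(QuMem)`, is of trace class. -/
theorem smul_one_mem_traceClass (c : ℂ) : (c • 1 : Op V.QuMem) ∈ TraceClass V.QuMem :=
  Submodule.smul_mem _ _ (Submodule.subset_span
    ⟨ContinuousLinearMap.isPositive_one, (hasSum_fintype _).summable⟩)

theorem diagOp_mem_CQ {f : V.ClMem → ℂ} (hf : Summable f) : diagOp f ∈ CQ V := by
  refine ⟨diagOp_mem_traceClass hf, fun m => f m • 1, fun m => smul_one_mem_traceClass _, ?_⟩
  convert hasSum_diagOp hf using 2 with m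
  rw [point_eq]
  simp [ket_apply]

theorem summable_entry {ρ : Op V.Mem} (h : ρ ∈ TraceClass V.Mem) :
    Summable fun m => entry m ρ := by
  induction h using Submodule.span_induction with
  | mem A hA => exact hA.2.comp_injective memOf_injective
  | zero => simp
  | add A B _ _ hA hB => simpa using hA.add hB
  | smul c A _ hA => simpa using hA.mul_left c

/-- Without quantum variables, a cq-operator is the diagonal operator of its entries. -/
theorem diagOp_entry {ρ : Op V.Mem} (h : ρ ∈ CQ V) : diagOp (fun m => entry m ρ) = ρ := by
  obtain ⟨_, r, _, hs⟩ := h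
  simp only [point_eq] at hs
  have e := funext (entry_of_hasSum hs)
  rw [e]
  exact hs.tsum_eq

theorem entry_nonneg {ρ : Op V.Mem} (h : ρ.IsPositive) (m : V.ClMem) : 0 ≤ entry m ρ :=
  (isPositive_iff_inner ρ).1 h _

theorem CQPos_diagOp {f : V.ClMem → ℂ} (hf : Summable f) (h0 : ∀ m, 0 ≤ f m) :
    CQPos (diagOp f) := ⟨diagOp_mem_CQ hf, tracePos_diagOp hf h0⟩

/-- The sum over `i` and the sum over `m` of `Fᵢ(m) |m⟩⟨m|` may be exchanged, as the double sum
converges absolutely in norm. -/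
theorem tsum_diagOp {ι : Type*} {F : ι → V.ClMem → ℂ}
    (hF : Summable fun p : ι × V.ClMem => F p.1 p.2) :
    ∑' i, diagOp (F i) = diagOp (fun m => ∑' i, F i m) := by
  have h := summable_smul_cproj hF fun p => p.2
  have h1 : ∑' i, diagOp (F i) = ∑' m, ∑' i, F i m • cproj m :=
    (h.tsum_comm (f := fun i m => F i m • cproj m)).symm
  rw [h1]
  refine tsum_congr fun m => ?_
  exact Summable.tsum_smul_const (hF.comp_injective (i := fun i => (i, m))
    (fun _ _ e => congrArg Prod.fst e)) (cproj m)

end Diagonal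

/-! ### Predicates and separability -/

section Judgments

theorem suppo_zero {X : Type*} : suppo (0 : Op X) = ⊥ := by
  refine le_bot_iff.1 (sInf_le ⟨0, .zero _, by simp, ?_⟩)
  simp

/-- A nonzero scalar has full support: the only projector fixing it is the identity. -/
theorem suppo_smul_one {X : Type*} {c : ℂ} (hc : c ≠ 0) : suppo (c • 1 : Op X) = ⊤ := by
  refine le_antisymm le_top (le_sInf ?_)
  rintro S ⟨P, hP, h, rfl⟩
  have h1 : P = 1 := by
    have h2 : c • (P * P) = c • (1 : Op X) := by
      rw [← h]
      ext ψ
      simp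
    rw [hP.isIdempotentElem.eq] at h2
    exact smul_right_injective _ hc h2
  rw [h1]
  intro ψ _
  exact ⟨ψ, rfl⟩

theorem fiber_memSplit_fst {V W : VarSet.{u, v}} (z : V.Mem) (z' : W.Mem) :
    (fiber (VarSet.memSplit V W) z' z).1 = VarSet.clUnion z.1 z'.1 := rfl

theorem fiber_memSplit_comm_fst {V W : VarSet.{u, v}} (z : V.Mem) (z' : W.Mem) :
    (fiber ((VarSet.memSplit V W).trans (Equiv.prodComm _ _)) z z').1 =
      VarSet.clUnion z.1 z'.1 := rfl

variable {V : VarSet.{u, v}} [IsEmpty V.Qu]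

/-- The support of a scalar on `ℓ²(QuMem)` is everything or `0`, so `Cla[e]` says that the entries
vanish where `e` is false. -/
theorem satisfies_cla_iff {ρ : Op V.Mem} {e : Expr V Bool} :
    Satisfies ρ (Cla e) ↔ ∀ m, e.eval m = false → entry m ρ = 0 := by
  refine forall_congr' fun m => ?_
  rw [block_eq]
  by_cases he : e.eval m = true
  · simp [Cla, Expr.map, he]
  · have he' : e.eval m = false := by simpa using he
    by_cases h0 : entry m ρ = 0
    · simp [h0, suppo_zero]
    · rw [suppo_smul_one h0]
      simp only [he', h0, Cla, Expr.map]
      simp only [Bool.false_eq_true, if_false, top_le_iff, forall_true_left, iff_false]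
      intro hb
      have hk : (ket default : L2 V.QuMem) ∈ (⊥ : Submodule ℂ (L2 V.QuMem)) := by
        change _ ∈ (⊥ : ClosedSubmodule ℂ (L2 V.QuMem)).toSubmodule
        rw [hb]; trivial
      have := norm_ket (default : V.QuMem)
      rw [(Submodule.mem_bot ℂ).1 hk] at this
      simp at this

variable {W : VarSet.{u, v}} [IsEmpty W.Qu]

/-- `|m₁⟩⟨m₁| ⊗ |m₂⟩⟨m₂| = |m₁m₂⟩⟨m₁m₂|`. -/
theorem tensorOp_cproj (m : (V.union W).ClMem) :
    tensorOp (VarSet.memSplit V W) (cproj (VarSet.clSplit V W m).1)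
      (cproj (VarSet.clSplit V W m).2) = cproj m := by
  classical
  refine op_ext fun z => ?_
  have hB : ampl ((VarSet.memSplit V W).trans (Equiv.prodComm _ _))
      (cproj (VarSet.clSplit V W m).2) (ket z) =
      (if (VarSet.clSplit V W z.1).2 = (VarSet.clSplit V W m).2 then (1 : ℂ) else 0) • ket z := by
    refine ampl_ket _ _ _ ?_
    rw [cproj_ket]
    by_cases h : (VarSet.clSplit V W z.1).2 = (VarSet.clSplit V W m).2
    · rw [if_pos h, one_smul]; exact if_pos h
    · rw [if_neg h, zero_smul]; exact if_neg h
  have hA : ampl (VarSet.memSplit V W) (cproj (VarSet.clSplit V W m).1) (ket z) =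
      (if (VarSet.clSplit V W z.1).1 = (VarSet.clSplit V W m).1 then (1 : ℂ) else 0) • ket z := by
    refine ampl_ket _ _ _ ?_
    rw [cproj_ket]
    by_cases h : (VarSet.clSplit V W z.1).1 = (VarSet.clSplit V W m).1
    · rw [if_pos h, one_smul]; exact if_pos h
    · rw [if_neg h, zero_smul]; exact if_neg h
  change ampl _ _ (ampl _ _ (ket z)) = _
  rw [hB, map_smul, hA, cproj_ket]
  have e : z.1 = m ↔ (VarSet.clSplit V W z.1).1 = (VarSet.clSplit V W m).1 ∧
      (VarSet.clSplit V W z.1).2 = (VarSet.clSplit V W m).2 := by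
    rw [← Prod.ext_iff, Equiv.apply_eq_iff_eq]
  by_cases h1 : (VarSet.clSplit V W z.1).1 = (VarSet.clSplit V W m).1 <;>
  by_cases h2 : (VarSet.clSplit V W z.1).2 = (VarSet.clSplit V W m).2 <;>
  simp [e, h1, h2]

theorem tracePos_smul_cproj {c : ℂ} (hc : 0 ≤ c) (m : V.ClMem) : TracePos (c • cproj m) := by
  classical
  have hs : Summable (Pi.single m c : V.ClMem → ℂ) :=
    summable_of_ne_finset_zero (s := {m}) fun b hb => by
      simp [Finset.mem_singleton.not.1 hb]
  have e : diagOp (Pi.single m c) = c • cproj m := by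
    refine op_ext fun z => ?_
    rw [diagOp_ket hs]
    change _ = c • cproj m (ket z)
    rw [cproj_ket, Pi.single_apply]
    by_cases h : z.1 = m <;> simp [h]
  rw [← e]
  refine tracePos_diagOp hs fun n => ?_
  rw [Pi.single_apply]
  split_ifs <;> simp [hc]

/-- Every cq-state without quantum variables is separable, since it is a sum of nonnegative
multiples of `|m₁⟩⟨m₁| ⊗ |m₂⟩⟨m₂|`. -/
theorem separable_of_CQPos {ρ : Op (V.union W).Mem} (h : CQPos ρ) : Separable ρ := by
  classical
  have hs := summable_entry h.1.1
  have h0 := entry_nonneg h.2.1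
  have hρ := diagOp_entry h.1
  refine ⟨(V.union W).Mem, fun z => entry z.1 ρ • cproj (VarSet.clSplit V W z.1).1,
    fun z => cproj (VarSet.clSplit V W z.1).2, fun z => tracePos_smul_cproj (h0 _) _,
    fun z => by simpa using tracePos_smul_cproj zero_le_one _, ?_⟩
  have e : (fun z : (V.union W).Mem => tensorOp (VarSet.memSplit V W)
      (entry z.1 ρ • cproj (VarSet.clSplit V W z.1).1) (cproj (VarSet.clSplit V W z.1).2)) =
      fun z => entry z.1 ρ • cproj z.1 := by
    funext z
    rw [← tensorOp_cproj z.1]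
    rfl
  rw [e]
  have hsum : HasSum (fun z : (V.union W).Mem => entry z.1 ρ • cproj z.1) ρ := by
    refine (memEquiv (V := V.union W)).hasSum_iff.1 ?_
    have := hasSum_diagOp hs
    rw [hρ] at this
    exact this
  refine ⟨fun J => ?_, fun σ hσ => isPositive_sub_of_hasSum hsum hσ⟩
  -- The rest of the sum outside `J` is again a sum of positive operators.
  have hJ : HasSum (fun z : (V.union W).Mem => if z ∈ J then 0 else entry z.1 ρ • cproj z.1)
      (ρ - ∑ z ∈ J, entry z.1 ρ • cproj z.1) := by
    have h1 : HasSum (fun z : (V.union W).Mem => if z ∈ J then entry z.1 ρ • cproj z.1 else 0)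
        (∑ z ∈ J, if z ∈ J then entry z.1 ρ • cproj z.1 else 0) :=
      hasSum_sum_of_ne_finset_zero fun z hz => if_neg hz
    rw [Finset.sum_congr rfl fun z hz => if_pos hz] at h1
    have h2 := hsum.sub h1
    have e2 : ∀ z : (V.union W).Mem, (entry z.1 ρ • cproj z.1 -
        if z ∈ J then entry z.1 ρ • cproj z.1 else 0) =
        if z ∈ J then 0 else entry z.1 ρ • cproj z.1 := fun z => by
      split_ifs <;> simp
    simp only [e2] at h2
    exact h2
  have hneg := isPositive_sub_of_hasSum hJ.neg (σ := 0) fun K => by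
    rw [zero_sub, ← Finset.sum_neg_distrib]
    simp only [neg_neg]
    refine ContinuousLinearMap.isPositive_sum _ fun z _ => ?_
    split_ifs
    · exact (isPositive_iff_inner _).2 fun ψ => by simp
    · exact (tracePos_smul_cproj (h0 _) _).1
  simpa using hneg

end Judgments

/-! ### Partial traces of diagonal operators -/

section Judgments
variable {V : VarSet.{u, v}} [IsEmpty V.Qu]
variable {W : VarSet.{u, v}} [IsEmpty W.Qu]

theorem ptrace₁_diagOp {f : (V.union W).ClMem → ℂ} (hf : Summable f) :
    ptrace₁ (diagOp f) = diagOp fun m => ∑' m', f (VarSet.clUnion m m') := by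
  have hF : Summable fun p : W.ClMem × V.ClMem => f (VarSet.clUnion p.2 p.1) :=
    hf.comp_injective ((VarSet.clSplit V W).symm.injective.comp Prod.swap_injective)
  have key : ∀ z' : W.Mem, restr (fiber (VarSet.memSplit V W) z') ∘L diagOp f ∘L
      (restr (fiber (VarSet.memSplit V W) z')).adjoint =
      diagOp fun m => f (VarSet.clUnion m z'.1) := fun z' => op_ext fun z => by
    have hm : Summable fun m => f (VarSet.clUnion m z'.1) :=
      hF.comp_injective (i := fun m => (z'.1, m)) fun _ _ e => congrArg Prod.snd e
    rw [diagOp_ket hm, ContinuousLinearMap.comp_apply, ContinuousLinearMap.comp_apply,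
      adjoint_restr_ket, diagOp_ket hf, map_smul, restr_ket_apply, fiber_memSplit_fst]
  rw [ptrace₁, tsum_congr key, ← (memEquiv (V := W)).tsum_eq]
  exact tsum_diagOp (F := fun m' m => f (VarSet.clUnion m m')) hF

theorem ptrace₂_diagOp {f : (V.union W).ClMem → ℂ} (hf : Summable f) :
    ptrace₂ (diagOp f) = diagOp fun m => ∑' m', f (VarSet.clUnion m' m) := by
  have hF : Summable fun p : V.ClMem × W.ClMem => f (VarSet.clUnion p.1 p.2) :=
    hf.comp_injective (VarSet.clSplit V W).symm.injective
  have key : ∀ z : V.Mem,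
      restr (fiber ((VarSet.memSplit V W).trans (Equiv.prodComm _ _)) z) ∘L diagOp f ∘L
      (restr (fiber ((VarSet.memSplit V W).trans (Equiv.prodComm _ _)) z)).adjoint =
      diagOp fun m => f (VarSet.clUnion z.1 m) := fun z => op_ext fun z' => by
    have hm : Summable fun m => f (VarSet.clUnion z.1 m) :=
      hF.comp_injective (i := fun m => (z.1, m)) fun _ _ e => congrArg Prod.snd e
    rw [diagOp_ket hm, ContinuousLinearMap.comp_apply, ContinuousLinearMap.comp_apply,
      adjoint_restr_ket, diagOp_ket hf, map_smul, restr_ket_apply, fiber_memSplit_comm_fst]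
  rw [ptrace₂, tsum_congr key, ← (memEquiv (V := V)).tsum_eq]
  exact tsum_diagOp (F := fun m' m => f (VarSet.clUnion m' m)) hF

end Judgments

/-! ### Semantics on mass functions -/

section MassSemantics

variable {V : VarSet.{u, v}}

open Classical in
/-- The point mass at `n`, with values in `[0, ∞]`. -/
def pointMass {X : Type*} (n : X) : X → ℝ≥0∞ := fun m => if m = n then 1 else 0

/-- Restriction of a mass function to the memories satisfying `p`. -/
def restrictMass (p : V.ClMem → Bool) (f : V.ClMem → ℝ≥0∞) : V.ClMem → ℝ≥0∞ :=
  fun m => if p m then f m else 0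

/-- The semantics of a classical program on `[0, ∞]`-valued mass functions. In `[0, ∞]` all sums
converge and commute, which makes it the link between the classical and the quantum semantics.
The quantum statements get the junk value `0`. -/
def denotMass : Prog V → (V.ClMem → ℝ≥0∞) → (V.ClMem → ℝ≥0∞)
  | .skip => fun f => f
  | .assign x e => fun f m' => ∑' m, f m * pointMass (upd m x (e.eval m)) m'
  | .sample x e => fun f m' =>
      ∑' m, f m * ∑' z, ((e.eval m).prob z : ℝ≥0∞) * pointMass (upd m x z) m'
  | .ite e c d => fun f m =>
      denotMass c (restrictMass e.eval f) m + denotMass d (restrictMass (fun m => !e.eval m) f) m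
  | .while e c => fun f m =>
      ∑' i : ℕ, restrictMass (fun m => !e.eval m)
        ((fun g => denotMass c (restrictMass e.eval g))^[i] f) m
  | .seq c d => fun f => denotMass d (denotMass c f)
  | .qinit _ _ => fun _ _ => 0
  | .qapply _ _ => fun _ _ => 0
  | .qmeasure _ _ _ => fun _ _ => 0

theorem tsum_pointMass {X : Type*} (n : X) : ∑' m, pointMass n m = 1 := by
  classical
  exact tsum_ite_eq n fun _ => (1 : ℝ≥0∞)

theorem tsum_pointMass_ne_top {X : Type*} (n : X) : ∑' m, pointMass n m ≠ ∞ := by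
  rw [tsum_pointMass]; exact ENNReal.one_ne_top

theorem tsum_mul_pointMass {X : Type*} (f : X → ℝ≥0∞) (m : X) :
    ∑' n, f n * pointMass n m = f m := by
  classical
  rw [tsum_eq_single m fun n hn => by simp [pointMass, Ne.symm hn]]
  simp [pointMass]

theorem pointMass_ne_top {X : Type*} (n m : X) : pointMass n m ≠ ∞ := by
  classical
  unfold pointMass; split_ifs <;> simp

theorem toReal_pointMass {X : Type*} (n m : X) : (pointMass n m).toReal = pointDistr n m := by
  classical
  unfold pointMass pointDistr; split_ifs <;> simp

/-! ### Linearity -/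

/-- `L` commutes with all weighted sums of mass functions. -/
def MassLinear {X : Type*} (L : (X → ℝ≥0∞) → (X → ℝ≥0∞)) : Prop :=
  ∀ (a : X → ℝ≥0∞) (F : X → X → ℝ≥0∞) (m' : X),
    L (fun m => ∑' i, a i * F i m) m' = ∑' i, a i * L (F i) m'

theorem MassLinear.comp {X : Type*} {L M : (X → ℝ≥0∞) → (X → ℝ≥0∞)} (hL : MassLinear L)
    (hM : MassLinear M) : MassLinear fun f => L (M f) := fun a F m' => by
  change L (M _) m' = ∑' i, a i * L (M (F i)) m'
  rw [funext (hM a F), hL]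

theorem MassLinear.tsum {X ι : Type*} {L : ι → (X → ℝ≥0∞) → (X → ℝ≥0∞)}
    (hL : ∀ i, MassLinear (L i)) : MassLinear fun f m => ∑' i, L i f m := fun a F m' => by
  simp only [hL _ a F, ← ENNReal.tsum_mul_left]
  exact ENNReal.tsum_comm

theorem MassLinear.kernel {X : Type*} (K : X → X → ℝ≥0∞) :
    MassLinear fun f m' => ∑' m, f m * K m m' := fun a F m' => by
  simp only [← ENNReal.tsum_mul_right, ← ENNReal.tsum_mul_left, mul_assoc]
  exact ENNReal.tsum_comm

theorem MassLinear.restrictMass (p : V.ClMem → Bool) :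
    MassLinear (restrictMass p) := fun a F m' => by
  unfold QRHL.restrictMass
  split_ifs <;> simp

theorem MassLinear.id {X : Type*} : MassLinear fun f : X → ℝ≥0∞ => f := fun _ _ _ => rfl

theorem MassLinear.iterate {X : Type*} {L : (X → ℝ≥0∞) → (X → ℝ≥0∞)} (hL : MassLinear L)
    (n : ℕ) : MassLinear L^[n] := by
  induction n with
  | zero => exact MassLinear.id
  | succ n ih => exact ih.comp hL

theorem denotMass_linear (c : Prog V) : MassLinear (denotMass c) := by
  induction c with
  | skip => exact MassLinear.id
  | assign x e => exact MassLinear.kernel _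
  | sample x e => exact MassLinear.kernel _
  | ite e c d hc hd =>
    intro a F m'
    have h1 := hc.comp (MassLinear.restrictMass e.eval) a F m'
    have h2 := hd.comp (MassLinear.restrictMass fun m => !e.eval m) a F m'
    simp only [denotMass, mul_add, ENNReal.tsum_add]
    rw [← h1, ← h2]
  | seq c d hc hd => exact hd.comp hc
  | qinit => intro a F m'; simp [denotMass]
  | qapply => intro a F m'; simp [denotMass]
  | qmeasure => intro a F m'; simp [denotMass]
  | _ e c hc =>
    exact MassLinear.tsum fun i =>
      (MassLinear.restrictMass _).comp ((hc.comp (MassLinear.restrictMass _)).iterate i)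

/-- The mass semantics is determined by its values on point masses. -/
theorem denotMass_eq_tsum (c : Prog V) (f : V.ClMem → ℝ≥0∞) (m' : V.ClMem) :
    denotMass c f m' = ∑' m, f m * denotMass c (pointMass m) m' := by
  rw [← denotMass_linear c f pointMass m', funext (tsum_mul_pointMass f)]

/-! ### Programs do not increase the mass -/

theorem tsum_restrictMass_add (p : V.ClMem → Bool) (f : V.ClMem → ℝ≥0∞) :
    ∑' m, restrictMass p f m + ∑' m, restrictMass (fun m => !p m) f m = ∑' m, f m := by
  rw [← ENNReal.tsum_add]
  refine tsum_congr fun m => ?_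
  cases h : p m <;> simp [restrictMass, h]

theorem tsum_restrictMass_le (p : V.ClMem → Bool) (f : V.ClMem → ℝ≥0∞) :
    ∑' m, restrictMass p f m ≤ ∑' m, f m := by
  rw [← tsum_restrictMass_add p f]; exact le_self_add

theorem tsum_iterate_le {X : Type*} {G : (X → ℝ≥0∞) → (X → ℝ≥0∞)}
    (hG : ∀ f, ∑' m, G f m ≤ ∑' m, f m) (f : X → ℝ≥0∞) (n : ℕ) :
    ∑' m, G^[n] f m ≤ ∑' m, f m := by
  induction n with
  | zero => exact le_rfl
  | succ n ih => rw [Function.iterate_succ_apply']; exact (hG _).trans ih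

theorem tsum_kernel_le {X Y : Type*} {K : X → Y → ℝ≥0∞} (hK : ∀ m, ∑' m', K m m' ≤ 1)
    (f : X → ℝ≥0∞) : ∑' m', ∑' m, f m * K m m' ≤ ∑' m, f m := by
  rw [ENNReal.tsum_comm]
  refine ENNReal.tsum_le_tsum fun m => ?_
  rw [ENNReal.tsum_mul_left]
  exact mul_le_of_le_one_right' (hK m)

theorem tsum_sample_le {X Z : Type*} (μ : SubDistr Z) (g : Z → X) :
    ∑' m', ∑' z, (μ.prob z : ℝ≥0∞) * pointMass (g z) m' ≤ 1 := by
  rw [ENNReal.tsum_comm]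
  simp only [ENNReal.tsum_mul_left, tsum_pointMass, mul_one]
  exact μ.sum_le_one

theorem tsum_denotMass_le (c : Prog V) (f : V.ClMem → ℝ≥0∞) :
    ∑' m, denotMass c f m ≤ ∑' m, f m := by
  induction c generalizing f with
  | skip => exact le_rfl
  | assign x e => exact tsum_kernel_le (fun m => (tsum_pointMass _).le) f
  | sample x e => exact tsum_kernel_le (fun m => tsum_sample_le _ _) f
  | ite e c d hc hd =>
    simp only [denotMass]
    rw [ENNReal.tsum_add, ← tsum_restrictMass_add e.eval f]
    exact add_le_add (hc _) (hd _)
  | seq c d hc hd => exact (hd _).trans (hc _)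
  | qinit => simp [denotMass]
  | qapply => simp [denotMass]
  | qmeasure => simp [denotMass]
  | _ e c hc =>
    simp only [denotMass]
    rw [ENNReal.tsum_comm]
    set G := fun g => denotMass c (restrictMass e.eval g) with hG
    -- The mass that has left the loop and the mass still inside add up to at most the initial mass.
    have key : ∀ n : ℕ, ∑ i ∈ Finset.range n, ∑' m, restrictMass (fun m => !e.eval m) (G^[i] f) m +
        ∑' m, G^[n] f m ≤ ∑' m, f m := by
      intro n
      induction n with
      | zero => simp
      | succ n ih =>
        refine le_trans ?_ ih
        rw [Finset.sum_range_succ, add_assoc, Function.iterate_succ_apply',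
          ← tsum_restrictMass_add e.eval (G^[n] f), add_comm (∑' m, restrictMass e.eval _ m)]
        exact add_le_add le_rfl (add_le_add le_rfl (hc _))
    rw [ENNReal.tsum_eq_iSup_nat]
    exact iSup_le fun n => le_self_add.trans (key n)

theorem tsum_denotMass_ne_top (c : Prog V) {f : V.ClMem → ℝ≥0∞} (hf : ∑' m, f m ≠ ∞) :
    ∑' m, denotMass c f m ≠ ∞ :=
  ne_top_of_le_ne_top hf (tsum_denotMass_le c f)

theorem tsum_restrictMass_ne_top (p : V.ClMem → Bool) {f : V.ClMem → ℝ≥0∞} (hf : ∑' m, f m ≠ ∞) :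
    ∑' m, restrictMass p f m ≠ ∞ :=
  ne_top_of_le_ne_top hf (tsum_restrictMass_le p f)

theorem tsum_loop_le (e : Expr V Bool) (c : Prog V) (f : V.ClMem → ℝ≥0∞) (i : ℕ) :
    ∑' m, (fun g => denotMass c (restrictMass e.eval g))^[i] f m ≤ ∑' m, f m :=
  tsum_iterate_le (fun g => (tsum_denotMass_le c _).trans (tsum_restrictMass_le _ g)) f i

/-! ### Comparison with the classical semantics -/

theorem restrictCl_toReal (p : V.ClMem → Bool) (f : V.ClMem → ℝ≥0∞) :
    restrictCl p (fun m => (f m).toReal) = fun m => (restrictMass p f m).toReal := by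
  funext m
  unfold restrictCl restrictMass
  split_ifs <;> simp

theorem denotCl_toReal (c : Prog V) (h : c.IsClassical) {f : V.ClMem → ℝ≥0∞}
    (hf : ∑' m, f m ≠ ∞) :
    denotCl c h (fun m => (f m).toReal) = fun m => (denotMass c f m).toReal := by
  induction c generalizing f with
  | skip => rfl
  | assign x e =>
    funext m'
    simp only [denotCl, denotMass]
    rw [ENNReal.tsum_toReal_eq fun m =>
      ENNReal.mul_ne_top (ENNReal.ne_top_of_tsum_ne_top hf m) (pointMass_ne_top _ _)]
    simp only [ENNReal.toReal_mul, toReal_pointMass]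
  | sample x e =>
    funext m'
    simp only [denotCl, denotMass]
    have h1 : ∀ m, ∑' z, ((e.eval m).prob z : ℝ≥0∞) * pointMass (upd m x z) m' ≠ ∞ := fun m =>
      ne_top_of_le_ne_top ENNReal.one_ne_top
        ((ENNReal.le_tsum m').trans (tsum_sample_le (e.eval m) (upd m x)))
    rw [ENNReal.tsum_toReal_eq fun m =>
      ENNReal.mul_ne_top (ENNReal.ne_top_of_tsum_ne_top hf m) (h1 m)]
    refine tsum_congr fun m => ?_
    rw [ENNReal.toReal_mul, ENNReal.tsum_toReal_eq fun z =>
      ENNReal.mul_ne_top ENNReal.coe_ne_top (pointMass_ne_top _ _)]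
    simp only [ENNReal.toReal_mul, toReal_pointMass, ENNReal.coe_toReal]
  | ite e c d hc hd =>
    funext m
    simp only [denotCl, denotMass]
    have h1 := tsum_restrictMass_ne_top e.eval hf
    have h2 := tsum_restrictMass_ne_top (fun m => !e.eval m) hf
    rw [restrictCl_toReal, restrictCl_toReal, hc _ h1, hd _ h2,
      ENNReal.toReal_add (ENNReal.ne_top_of_tsum_ne_top (tsum_denotMass_ne_top c h1) m)
        (ENNReal.ne_top_of_tsum_ne_top (tsum_denotMass_ne_top d h2) m)]
  | seq c d hc hd =>
    simp only [denotCl, denotMass]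
    rw [hc _ hf, hd _ (tsum_denotMass_ne_top c hf)]
  | qinit => exact h.elim
  | qapply => exact h.elim
  | qmeasure => exact h.elim
  | _ e c hc =>
    have hit : ∀ i : ℕ, (fun ν => denotCl c h (restrictCl e.eval ν))^[i] (fun m => (f m).toReal) =
        fun m => ((fun g => denotMass c (restrictMass e.eval g))^[i] f m).toReal := by
      intro i
      induction i with
      | zero => rfl
      | succ i ih =>
        rw [Function.iterate_succ_apply', Function.iterate_succ_apply', ih, restrictCl_toReal]
        exact hc h (tsum_restrictMass_ne_top _ (ne_top_of_le_ne_top hf (tsum_loop_le e c f i)))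
    funext m
    simp only [denotCl, denotMass]
    rw [ENNReal.tsum_toReal_eq fun i => ENNReal.ne_top_of_tsum_ne_top
      (tsum_restrictMass_ne_top _ (ne_top_of_le_ne_top hf (tsum_loop_le e c f i))) m]
    refine tsum_congr fun i => ?_
    rw [hit i, restrictCl_toReal]

theorem denotCl_pointDistr (c : Prog V) (h : c.IsClassical) (n m : V.ClMem) :
    denotCl c h (pointDistr n) m = (denotMass c (pointMass n) m).toReal := by
  have := denotCl_toReal c h (tsum_pointMass_ne_top n)
  simp only [toReal_pointMass] at this
  exact congrFun this m

/-! ### Comparison with the quantum semantics -/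

variable [IsEmpty V.Qu]

/-- The cq-state `∑ₘ f(m) |m⟩⟨m|` of a mass function `f` of finite total mass. -/
def massOp (f : V.ClMem → ℝ≥0∞) : Op V.Mem := diagOp fun m => ((f m).toReal : ℂ)

theorem summable_massOp {ι : Type*} {f : ι → ℝ≥0∞} (hf : ∑' m, f m ≠ ∞) :
    Summable fun m => ((f m).toReal : ℂ) :=
  Complex.ofRealCLM.summable (ENNReal.summable_toReal hf)

theorem tsum_massOp {ι : Type*} {F : ι → V.ClMem → ℝ≥0∞} (hF : ∑' i, ∑' m, F i m ≠ ∞) :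
    ∑' i, massOp (F i) = massOp fun m => ∑' i, F i m := by
  have hs : ∑' p : ι × V.ClMem, F p.1 p.2 ≠ ∞ := by rwa [ENNReal.tsum_prod (f := F)]
  have h := tsum_diagOp (F := fun i m => ((F i m).toReal : ℂ)) (summable_massOp hs)
  refine h.trans (congrArg diagOp (funext fun m => ?_))
  rw [ENNReal.tsum_toReal_eq fun i => ENNReal.ne_top_of_tsum_ne_top hs (i, m), Complex.ofReal_tsum]

theorem entry_massOp {f : V.ClMem → ℝ≥0∞} (hf : ∑' m, f m ≠ ∞) (m : V.ClMem) :
    entry m (massOp f) = ((f m).toReal : ℂ) :=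
  entry_diagOp (summable_massOp hf) m

theorem smul_cproj_eq_massOp (a : ℝ≥0∞) (n : V.ClMem) :
    (a.toReal : ℂ) • cproj n = massOp fun m => a * pointMass n m := by
  classical
  rw [massOp, diagOp, tsum_eq_single n fun m hm => by simp [pointMass, hm]]
  simp [pointMass]

theorem restrictCQ_massOp (p : V.ClMem → Bool) {f : V.ClMem → ℝ≥0∞} (hf : ∑' m, f m ≠ ∞) :
    restrictCQ p (massOp f) = massOp (restrictMass p f) := by
  refine tsum_congr fun m => ?_
  rw [point_block, entry_massOp hf]
  by_cases h : p m = true <;> simp [restrictMass, h]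

theorem denot_massOp (c : Prog V) (h : c.IsClassical) {f : V.ClMem → ℝ≥0∞}
    (hf : ∑' m, f m ≠ ∞) : denot c (massOp f) = massOp (denotMass c f) := by
  induction c generalizing f with
  | skip => rfl
  | assign x e =>
    have hm := tsum_denotMass_ne_top (.assign x e) hf
    simp only [denotMass] at hm
    simp only [denot, denotMass, point_block, entry_massOp hf, smul_cproj_eq_massOp]
    exact tsum_massOp (by rwa [ENNReal.tsum_comm])
  | sample x e =>
    have hm := tsum_denotMass_ne_top (.sample x e) hf
    simp only [denotMass] at hm
    rw [ENNReal.tsum_comm] at hm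
    simp only [denot, denotMass, point_block, entry_massOp hf]
    rw [← tsum_massOp hm]
    refine tsum_congr fun m => ?_
    have h1 : ∀ z, (((e.eval m).prob z : ℝ) : ℂ) • ((f m).toReal : ℂ) • cproj (upd m x z) =
        massOp fun m' => f m * (((e.eval m).prob z : ℝ≥0∞) * pointMass (upd m x z) m') := by
      intro z
      simp only [← mul_assoc]
      rw [← smul_cproj_eq_massOp, smul_smul, ENNReal.toReal_mul, ENNReal.coe_toReal,
        Complex.ofReal_mul, mul_comm]
    rw [tsum_congr h1]
    simp only [← ENNReal.tsum_mul_left]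
    refine tsum_massOp ?_
    have h2 := ENNReal.ne_top_of_tsum_ne_top hm m
    simp only [← ENNReal.tsum_mul_left] at h2
    rwa [ENNReal.tsum_comm]
  | ite e c d hc hd =>
    have h1 := tsum_restrictMass_ne_top e.eval hf
    have h2 := tsum_restrictMass_ne_top (fun m => !e.eval m) hf
    have h3 := tsum_denotMass_ne_top c h1
    have h4 := tsum_denotMass_ne_top d h2
    simp only [denot, denotMass]
    rw [restrictCQ_massOp _ hf, restrictCQ_massOp _ hf, hc h.1 h1, hd h.2 h2, massOp, massOp,
      ← diagOp_add (summable_massOp h3) (summable_massOp h4)]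
    refine congrArg diagOp (funext fun m => ?_)
    rw [ENNReal.toReal_add (ENNReal.ne_top_of_tsum_ne_top h3 m)
      (ENNReal.ne_top_of_tsum_ne_top h4 m), Complex.ofReal_add]
  | seq c d hc hd =>
    simp only [denot, denotMass]
    rw [hc h.1 hf, hd h.2 (tsum_denotMass_ne_top c hf)]
  | qinit => exact h.elim
  | qapply => exact h.elim
  | qmeasure => exact h.elim
  | _ e c hc =>
    have hfin := fun i => ne_top_of_le_ne_top hf (tsum_loop_le e c f i)
    have hit : ∀ i : ℕ, (fun σ => denot c (restrictCQ e.eval σ))^[i] (massOp f) =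
        massOp ((fun g => denotMass c (restrictMass e.eval g))^[i] f) := by
      intro i
      induction i with
      | zero => rfl
      | succ i ih =>
        rw [Function.iterate_succ_apply', Function.iterate_succ_apply', ih,
          restrictCQ_massOp _ (hfin i)]
        exact hc h (tsum_restrictMass_ne_top _ (hfin i))
    have hm := tsum_denotMass_ne_top (.while e c) hf
    simp only [denotMass] at hm
    rw [ENNReal.tsum_comm] at hm
    simp only [denot, denotMass]
    rw [← tsum_massOp hm]
    refine tsum_congr fun i => ?_
    rw [hit i, restrictCQ_massOp _ (hfin i)]

end MassSemantics

/-! ### States as mass functions -/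

section States

variable {V W : VarSet.{u, v}}

theorem tsum_clUnion (f : (V.union W).ClMem → ℝ≥0∞) :
    ∑' m, ∑' m', f (VarSet.clUnion m m') = ∑' n, f n := by
  rw [← ENNReal.tsum_prod (f := fun m m' => f (VarSet.clUnion m m'))]
  exact (VarSet.clSplit V W).symm.tsum_eq f

theorem tsum_clUnion' (f : (V.union W).ClMem → ℝ≥0∞) :
    ∑' m', ∑' m, f (VarSet.clUnion m m') = ∑' n, f n := by
  rw [ENNReal.tsum_comm, tsum_clUnion]

/-- Compositions of an absolutely summable function with a subprobability kernel converge
absolutely, as `∑ₘ ∑ₙ |c(m)| K(m, n) ≤ ∑ₘ |c(m)|`. -/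
theorem summable_mul_kernel {X Y : Type*} {c : X → ℂ} (hc : Summable c)
    {K : X → Y → ℝ≥0∞} (hK : ∀ m, ∑' m', K m m' ≤ 1) :
    Summable fun p : X × Y => c p.1 * ((K p.1 p.2).toReal : ℂ) := by
  have h1 : ∑' p : X × Y, ENNReal.ofReal ‖c p.1‖ * K p.1 p.2 ≠ ∞ := by
    rw [ENNReal.tsum_prod (f := fun m m' => ENNReal.ofReal ‖c m‖ * K m m'), ENNReal.tsum_comm]
    have : ∑' m, ENNReal.ofReal ‖c m‖ ≠ ∞ := hc.norm.tsum_ofReal_ne_top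
    refine ne_top_of_le_ne_top this ?_
    rw [ENNReal.tsum_comm]
    refine ENNReal.tsum_le_tsum fun m => ?_
    rw [ENNReal.tsum_mul_left]
    exact mul_le_of_le_one_right' (hK m)
  refine Summable.of_norm_bounded (ENNReal.summable_toReal h1) fun p => le_of_eq ?_
  rw [norm_mul, ENNReal.toReal_mul, ENNReal.toReal_ofReal (norm_nonneg _), Complex.norm_real,
    Real.norm_of_nonneg ENNReal.toReal_nonneg]

variable [IsEmpty V.Qu] [IsEmpty W.Qu]

theorem CQPos_massOp {f : V.ClMem → ℝ≥0∞} (hf : ∑' m, f m ≠ ∞) : CQPos (massOp f) :=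
  CQPos_diagOp (summable_massOp hf) fun m => by exact_mod_cast ENNReal.toReal_nonneg

theorem exists_massOp_of_mem_CQ {ρ : Op V.Mem} (h : ρ ∈ CQ V) (h0 : ρ.IsPositive) :
    ∃ f : V.ClMem → ℝ≥0∞, ∑' m, f m ≠ ∞ ∧ massOp f = ρ := by
  have hs := summable_entry h.1
  have hnn := entry_nonneg h0
  refine ⟨fun m => ENNReal.ofReal (entry m ρ).re,
    (Complex.reCLM.summable hs).tsum_ofReal_ne_top, ?_⟩
  rw [← diagOp_entry h]
  refine congrArg diagOp (funext fun m => ?_)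
  rw [diagOp_entry h]
  have h1 := Complex.nonneg_iff.1 (hnn m)
  rw [ENNReal.toReal_ofReal h1.1]
  exact Complex.ext rfl h1.2

theorem massOp_injective {f g : V.ClMem → ℝ≥0∞} (hf : ∑' m, f m ≠ ∞) (hg : ∑' m, g m ≠ ∞)
    (h : massOp f = massOp g) (m : V.ClMem) : f m = g m := by
  have e := congrArg (entry m) h
  rw [entry_massOp hf, entry_massOp hg, Complex.ofReal_inj] at e
  exact (ENNReal.toReal_eq_toReal_iff' (ENNReal.ne_top_of_tsum_ne_top hf m)
    (ENNReal.ne_top_of_tsum_ne_top hg m)).1 e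

theorem tr_massOp {f : V.ClMem → ℝ≥0∞} (hf : ∑' m, f m ≠ ∞) :
    tr (massOp f) = ((∑' m, f m).toReal : ℂ) := by
  rw [massOp, tr_diagOp (summable_massOp hf),
    ENNReal.tsum_toReal_eq (ENNReal.ne_top_of_tsum_ne_top hf), Complex.ofReal_tsum]

theorem ptrace₁_massOp {f : (V.union W).ClMem → ℝ≥0∞} (hf : ∑' m, f m ≠ ∞) :
    ptrace₁ (massOp f) = massOp fun m => ∑' m', f (VarSet.clUnion m m') := by
  rw [massOp, ptrace₁_diagOp (summable_massOp hf)]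
  refine congrArg diagOp (funext fun m => ?_)
  rw [ENNReal.tsum_toReal_eq fun m' => ENNReal.ne_top_of_tsum_ne_top hf _, Complex.ofReal_tsum]

theorem ptrace₂_massOp {f : (V.union W).ClMem → ℝ≥0∞} (hf : ∑' m, f m ≠ ∞) :
    ptrace₂ (massOp f) = massOp fun m => ∑' m', f (VarSet.clUnion m' m) := by
  rw [massOp, ptrace₂_diagOp (summable_massOp hf)]
  refine congrArg diagOp (funext fun m => ?_)
  rw [ENNReal.tsum_toReal_eq fun m' => ENNReal.ne_top_of_tsum_ne_top hf _, Complex.ofReal_tsum]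

theorem satisfies_massOp_iff {f : V.ClMem → ℝ≥0∞} (hf : ∑' m, f m ≠ ∞) {e : Expr V Bool} :
    Satisfies (massOp f) (Cla e) ↔ ∀ m, e.eval m = false → f m = 0 := by
  rw [satisfies_cla_iff]
  refine forall₂_congr fun m _ => ?_
  rw [entry_massOp hf, Complex.ofReal_eq_zero,
    ENNReal.toReal_eq_zero_iff, or_iff_left (ENNReal.ne_top_of_tsum_ne_top hf m)]

/-! ### Superoperators given by subprobability kernels -/

/-- The superoperator `|m⟩⟨m| ↦ ∑ₙ K(m, n) |n⟩⟨n|` of a subprobability kernel `K`. -/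
def kernelOp (K : V.ClMem → W.ClMem → ℝ≥0∞) (hK : ∀ m, ∑' m', K m m' ≤ 1) :
    CQ V →ₗ[ℂ] CQ W where
  toFun ρ := ⟨diagOp fun m' => ∑' m, entry m (ρ : Op V.Mem) * ((K m m').toReal : ℂ),
    diagOp_mem_CQ ((summable_mul_kernel (summable_entry ρ.2.1) hK).prod_symm.prod)⟩
  map_add' ρ σ := by
    have h1 := (summable_mul_kernel (summable_entry ρ.2.1) hK).prod_symm
    have h2 := (summable_mul_kernel (summable_entry σ.2.1) hK).prod_symm
    refine Subtype.ext ((congrArg diagOp (funext fun m' => ?_)).trans (diagOp_add h1.prod h2.prod))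
    refine Eq.trans ?_ ((h1.prod_factor m').tsum_add (h2.prod_factor m'))
    refine tsum_congr fun m => ?_
    rw [Submodule.coe_add, map_add, add_mul]
    rfl
  map_smul' c ρ := by
    have h1 := (summable_mul_kernel (summable_entry ρ.2.1) hK).prod_symm
    refine Subtype.ext ((congrArg diagOp (funext fun m' => ?_)).trans (diagOp_smul c h1.prod))
    refine Eq.trans ?_ tsum_mul_left
    refine tsum_congr fun m => ?_
    rw [Submodule.coe_smul, map_smul, smul_eq_mul, mul_assoc]

theorem kernelOp_massOp {K : V.ClMem → W.ClMem → ℝ≥0∞} (hK : ∀ m, ∑' m', K m m' ≤ 1)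
    {f : V.ClMem → ℝ≥0∞} (hf : ∑' m, f m ≠ ∞) (h : massOp f ∈ CQ V) :
    (kernelOp K hK ⟨massOp f, h⟩ : Op W.Mem) = massOp fun m' => ∑' m, f m * K m m' := by
  refine congrArg diagOp (funext fun m' => ?_)
  have hfin : ∀ m, K m m' ≠ ∞ := fun m =>
    ne_top_of_le_ne_top ENNReal.one_ne_top ((ENNReal.le_tsum m').trans (hK m))
  rw [ENNReal.tsum_toReal_eq fun m =>
    ENNReal.mul_ne_top (ENNReal.ne_top_of_tsum_ne_top hf m) (hfin m), Complex.ofReal_tsum]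
  refine tsum_congr fun m => ?_
  rw [entry_massOp hf, ENNReal.toReal_mul, Complex.ofReal_mul]

/-- Complete positivity of `kernelOp K`: the form of the image at the vectors `ψᵢ` is
`∑ₙ ∑ₘ K(m, n) ∑ᵢⱼ ⟨φᵢ|Rᵢⱼ|φⱼ⟩` with `φᵢ = ψᵢ(n) |m⟩`. -/
theorem kernelOp_matrixPos {K : V.ClMem → W.ClMem → ℝ≥0∞} (hK : ∀ m, ∑' m', K m m' ≤ 1)
    (n : ℕ) (R : Fin n → Fin n → CQ V) (hR : MatrixPos fun i j => (R i j : Op V.Mem)) :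
    MatrixPos fun i j => (kernelOp K hK (R i j) : Op W.Mem) := by
  intro ψ
  have hs := fun i j => (summable_mul_kernel (summable_entry (R i j).2.1) hK).prod_symm
  have h1 : HasSum (fun m' => ∑ i, ∑ j,
      (∑' m, entry m (R i j : Op V.Mem) * ((K m m').toReal : ℂ)) *
      (ψ j (memOf m') * conj (ψ i (memOf m'))))
      (∑ i, ∑ j, inner ℂ (ψ i) ((kernelOp K hK (R i j) : Op W.Mem) (ψ j))) :=
    hasSum_sum fun i _ => hasSum_sum fun j _ => hasSum_inner_diagOp (hs i j).prod (ψ i) (ψ j)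
  refine h1.nonneg fun m' => ?_
  have h2 : HasSum (fun m => ∑ i, ∑ j, (entry m (R i j : Op V.Mem) * ((K m m').toReal : ℂ)) *
      (ψ j (memOf m') * conj (ψ i (memOf m'))))
      (∑ i, ∑ j, (∑' m, entry m (R i j : Op V.Mem) * ((K m m').toReal : ℂ)) *
      (ψ j (memOf m') * conj (ψ i (memOf m')))) :=
    hasSum_sum fun i _ => hasSum_sum fun j _ => ((hs i j).prod_factor m').hasSum.mul_right _
  refine h2.nonneg fun m => ?_
  have h3 := hR fun i => ψ i (memOf m') • ket (memOf m)
  have h4 : ∑ i, ∑ j, (entry m (R i j : Op V.Mem) * ((K m m').toReal : ℂ)) *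
      (ψ j (memOf m') * conj (ψ i (memOf m'))) = ((K m m').toReal : ℂ) *
      ∑ i, ∑ j, inner ℂ (ψ i (memOf m') • ket (memOf m))
        ((R i j : Op V.Mem) (ψ j (memOf m') • ket (memOf m))) := by
    simp only [Finset.mul_sum]
    refine Finset.sum_congr rfl fun i _ => Finset.sum_congr rfl fun j _ => ?_
    rw [map_smul, inner_smul_left, inner_smul_right, entry_eq]
    ring
  simp only [h4]
  exact mul_nonneg (by exact_mod_cast ENNReal.toReal_nonneg) h3

theorem isCQSuperop_kernelOp {K : V.ClMem → W.ClMem → ℝ≥0∞} (hK : ∀ m, ∑' m', K m m' ≤ 1) :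
    IsCQSuperop (kernelOp K hK) where
  completelyPositive := kernelOp_matrixPos hK
  traceDecreasing := by
    rintro ⟨ρ, hρ⟩ h0
    obtain ⟨f, hf, rfl⟩ := exists_massOp_of_mem_CQ hρ h0
    have hle := tsum_kernel_le hK f
    rw [kernelOp_massOp hK hf, tr_massOp hf, tr_massOp (ne_top_of_le_ne_top hf hle)]
    exact_mod_cast ENNReal.toReal_mono hf hle

end States

/-! ### Equivalence of the judgments -/

section Equivalence

variable {V : VarSet.{u, v}} [IsEmpty V.Qu] {c₁ c₂ : Prog V} {a b : Expr (V.union V) Bool}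

/-- The joint output state at a point input is the coupling required by pRHL. -/
theorem exists_coupling (h₁ : c₁.IsClassical) (h₂ : c₂.IsClassical) (m₁ m₂ : V.ClMem)
    {ρ : Op (V.union V).Mem} (hρ : CQPos ρ) (hb : Satisfies ρ (Cla b))
    (e₁ : ptrace₁ ρ = denot c₁ (ptrace₁ (massOp (pointMass (VarSet.clUnion m₁ m₂)))))
    (e₂ : ptrace₂ ρ = denot c₂ (ptrace₂ (massOp (pointMass (VarSet.clUnion m₁ m₂))))) :
    ∃ μ : SubDistr (V.union V).ClMem,
      (∀ m, denotCl c₁ h₁ (pointDistr m₁) m = ∑' m', (μ.prob (VarSet.clUnion m m') : ℝ)) ∧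
      (∀ m, denotCl c₂ h₂ (pointDistr m₂) m = ∑' m', (μ.prob (VarSet.clUnion m' m) : ℝ)) ∧
      ∀ m ∈ μ.supp, b.eval m = true := by
  classical
  obtain ⟨f, hf, rfl⟩ := exists_massOp_of_mem_CQ hρ.1 hρ.2.1
  have hinj : ∀ m n m' n' : V.ClMem,
      (VarSet.clUnion m n : (V.union V).ClMem) = VarSet.clUnion m' n' ↔ m = m' ∧ n = n' := by
    intro m n m' n'
    rw [VarSet.clUnion, VarSet.clUnion, Equiv.apply_eq_iff_eq, Prod.mk.injEq]
  have p₁ : ∀ m : V.ClMem, ∑' m' : V.ClMem, pointMass (VarSet.clUnion m₁ m₂ : (V.union V).ClMem)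
      (VarSet.clUnion m m') = pointMass m₁ m := fun m => by
    simp only [pointMass, hinj]
    by_cases h : m = m₁ <;> simp [h]
  have p₂ : ∀ m : V.ClMem, ∑' m' : V.ClMem, pointMass (VarSet.clUnion m₁ m₂ : (V.union V).ClMem)
      (VarSet.clUnion m' m) = pointMass m₂ m := fun m => by
    simp only [pointMass, hinj]
    by_cases h : m = m₂ <;> simp [h]
  rw [ptrace₁_massOp hf, ptrace₁_massOp (tsum_pointMass_ne_top _), funext p₁,
    denot_massOp c₁ h₁ (tsum_pointMass_ne_top m₁)] at e₁
  rw [ptrace₂_massOp hf, ptrace₂_massOp (tsum_pointMass_ne_top _), funext p₂,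
    denot_massOp c₂ h₂ (tsum_pointMass_ne_top m₂)] at e₂
  have q₁ := massOp_injective (by rwa [tsum_clUnion])
    (tsum_denotMass_ne_top c₁ (tsum_pointMass_ne_top m₁)) e₁
  have q₂ := massOp_injective (by rwa [tsum_clUnion'])
    (tsum_denotMass_ne_top c₂ (tsum_pointMass_ne_top m₂)) e₂
  have hfin := ENNReal.ne_top_of_tsum_ne_top hf
  refine ⟨⟨fun m => (f m).toNNReal, ?_⟩, fun m => ?_, fun m => ?_, fun m hm => ?_⟩
  · -- The total mass of `f` is that of its first marginal, an output distribution of `c₁`.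
    simp only [ENNReal.coe_toNNReal (hfin _)]
    rw [← tsum_clUnion, tsum_congr q₁]
    exact (tsum_denotMass_le c₁ _).trans (tsum_pointMass m₁).le
  · rw [denotCl_pointDistr, ← q₁, ENNReal.tsum_toReal_eq fun _ => hfin _]
    rfl
  · rw [denotCl_pointDistr, ← q₂, ENNReal.tsum_toReal_eq fun _ => hfin _]
    rfl
  · by_contra hbm
    have h0 := (satisfies_massOp_iff hf).1 hb m (by simpa using hbm)
    simp [SubDistr.supp, h0] at hm

theorem pRHL_of_qRHL (h₁ : c₁.IsClassical) (h₂ : c₂.IsClassical)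
    (h : qRHL (Cla a) c₁ c₂ (Cla b)) : pRHL a c₁ c₂ h₁ h₂ b := by
  intro m₁ m₂ ha
  classical
  have hpt := tsum_pointMass_ne_top (VarSet.clUnion m₁ m₂ : (V.union V).ClMem)
  have hcq := CQPos_massOp hpt
  obtain ⟨ρ', hρ', -, hb, e₁, e₂⟩ := h _ hcq (separable_of_CQPos hcq)
    ((satisfies_massOp_iff hpt).2 fun m hm => by
      have : m ≠ VarSet.clUnion m₁ m₂ := fun e => by rw [e, ha] at hm; cases hm
      simp [pointMass, this])
  exact exists_coupling h₁ h₂ m₁ m₂ hρ' hb e₁ e₂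

theorem qRHL_of_qRHLFirst {A B : Predicate (V.union V)} (h : qRHLFirst A c₁ c₂ B) :
    qRHL A c₁ c₂ B := by
  intro ρ hρ _ hA
  obtain ⟨ρ', hρ', hB, e⟩ := h ρ hρ hA
  exact ⟨ρ', hρ', separable_of_CQPos hρ', hB, e⟩

theorem qRHLFirst_of_qRHLUniform {A B : Predicate (V.union V)} (h : qRHLUniform A c₁ c₂ B) :
    qRHLFirst A c₁ c₂ B := by
  obtain ⟨E, hE, h⟩ := h
  intro ρ hρ hA
  obtain ⟨hB, e⟩ := h ⟨ρ, hρ.1⟩ hρ hA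
  refine ⟨E ⟨ρ, hρ.1⟩, ?_, hB, e⟩
  have hpos : (E ⟨ρ, hρ.1⟩ : Op (V.union V).Mem).IsPositive := by
    rw [isPositive_iff_inner]
    intro ψ
    have := hE.completelyPositive 1 (fun _ _ => ⟨ρ, hρ.1⟩)
      (fun φ => by simpa using (isPositive_iff_inner ρ).1 hρ.2.1 (φ 0)) fun _ => ψ
    simpa using this
  obtain ⟨f, hf, hfe⟩ := exists_massOp_of_mem_CQ (E ⟨ρ, hρ.1⟩).2 hpos
  rw [← hfe]
  exact CQPos_massOp hf

/-- Averaging the couplings over the initial memory: the kernel that maps `m₁m₂` to its coupling is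
a superoperator witnessing the uniform judgment. -/
theorem qRHLUniform_of_pRHL (h₁ : c₁.IsClassical) (h₂ : c₂.IsClassical)
    (h : pRHL a c₁ c₂ h₁ h₂ b) : qRHLUniform (Cla a) c₁ c₂ (Cla b) := by
  classical
  -- For initial memories violating `a` any row will do: they have mass `0`.
  have hn : ∀ n : (V.union V).ClMem, ∃ k : (V.union V).ClMem → ℝ≥0∞, ∑' m, k m ≤ 1 ∧
      (a.eval n = true →
        (∀ m, ∑' m', k (VarSet.clUnion m m') =
          denotMass c₁ (pointMass (VarSet.clSplit V V n).1) m) ∧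
        (∀ m, ∑' m', k (VarSet.clUnion m' m) =
          denotMass c₂ (pointMass (VarSet.clSplit V V n).2) m) ∧
        ∀ m, b.eval m = false → k m = 0) := by
    intro n
    by_cases ha : a.eval n = true
    · have hcl : VarSet.clUnion (VarSet.clSplit V V n).1 (VarSet.clSplit V V n).2 = n :=
        (VarSet.clSplit V V).symm_apply_apply n
      obtain ⟨μ, e₁, e₂, hb⟩ := h (VarSet.clSplit V V n).1 (VarSet.clSplit V V n).2
        (by rw [hcl]; exact ha)
      have hμ : ∑' m, (μ.prob m : ℝ≥0∞) ≠ ∞ :=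
        ne_top_of_le_ne_top ENNReal.one_ne_top μ.sum_le_one
      refine ⟨fun m => μ.prob m, μ.sum_le_one, fun _ => ⟨fun m => ?_, fun m => ?_, fun m hm => ?_⟩⟩
      · have := e₁ m
        rw [denotCl_pointDistr] at this
        refine (ENNReal.toReal_eq_toReal_iff'
          (ENNReal.ne_top_of_tsum_ne_top (by rwa [tsum_clUnion]) m)
          (ENNReal.ne_top_of_tsum_ne_top
            (tsum_denotMass_ne_top c₁ (tsum_pointMass_ne_top _)) m)).1 ?_
        rw [this, ENNReal.tsum_toReal_eq fun _ => ENNReal.coe_ne_top]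
        rfl
      · have := e₂ m
        rw [denotCl_pointDistr] at this
        refine (ENNReal.toReal_eq_toReal_iff'
          (ENNReal.ne_top_of_tsum_ne_top (by rwa [tsum_clUnion']) m)
          (ENNReal.ne_top_of_tsum_ne_top
            (tsum_denotMass_ne_top c₂ (tsum_pointMass_ne_top _)) m)).1 ?_
        rw [this, ENNReal.tsum_toReal_eq fun _ => ENNReal.coe_ne_top]
        rfl
      · by_contra h0
        have := hb m (pos_iff_ne_zero.2 fun e => h0 (ENNReal.coe_eq_zero.2 e))
        rw [this] at hm
        cases hm
    · exact ⟨fun _ => 0, by simp, fun h => absurd h ha⟩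
  choose K hK hKa using hn
  refine ⟨kernelOp K hK, isCQSuperop_kernelOp hK, ?_⟩
  rintro ⟨ρ, hρ⟩ hpos hA
  obtain ⟨f, hf, rfl⟩ := exists_massOp_of_mem_CQ hρ hpos.2.1
  have hfa := (satisfies_massOp_iff hf).1 hA
  have hfin := ne_top_of_le_ne_top hf (tsum_kernel_le hK f)
  rw [kernelOp_massOp hK hf, ptrace₁_massOp hfin, ptrace₂_massOp hfin, satisfies_massOp_iff hfin]
  dsimp only
  rw [ptrace₁_massOp hf, ptrace₂_massOp hf,
    denot_massOp c₁ h₁ (by rwa [tsum_clUnion]), denot_massOp c₂ h₂ (by rwa [tsum_clUnion'])]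
  have hcase : ∀ {g g' : (V.union V).ClMem → ℝ≥0∞}, (∀ n, a.eval n = true → g n = g' n) →
      ∑' n, f n * g n = ∑' n, f n * g' n := fun hg => tsum_congr fun n => by
    by_cases ha : a.eval n = true
    · rw [hg n ha]
    · rw [hfa n (by simpa using ha), zero_mul, zero_mul]
  refine ⟨fun m hm => ?_, congrArg massOp (funext fun m => ?_),
    congrArg massOp (funext fun m => ?_)⟩
  · rw [hcase fun n ha => (hKa n ha).2.2 m hm]
    simp
  · rw [ENNReal.tsum_comm]
    simp only [ENNReal.tsum_mul_left]
    rw [hcase fun n ha => (hKa n ha).1 m, denotMass_eq_tsum, ← tsum_clUnion]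
    simp only [← ENNReal.tsum_mul_right]
    refine tsum_congr fun m₁ => tsum_congr fun m₂ => ?_
    rw [VarSet.clUnion, Equiv.apply_symm_apply]
  · rw [ENNReal.tsum_comm]
    simp only [ENNReal.tsum_mul_left]
    rw [hcase fun n ha => (hKa n ha).2.1 m, denotMass_eq_tsum, ← tsum_clUnion']
    simp only [← ENNReal.tsum_mul_right]
    refine tsum_congr fun m₂ => tsum_congr fun m₁ => ?_
    rw [VarSet.clUnion, Equiv.apply_symm_apply]

end Equivalence

end QRHL

end

theorem mainTheorem3 (V : QRHL.VarSet.{u, v}) (hV : IsEmpty V.Qu)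
    (c₁ c₂ : QRHL.Prog V) (h₁ : c₁.IsClassical) (h₂ : c₂.IsClassical)
    (a b : QRHL.Expr (V.union V) Bool) :
    List.TFAE
      [QRHL.pRHL a c₁ c₂ h₁ h₂ b,
       QRHL.qRHL (QRHL.Cla a) c₁ c₂ (QRHL.Cla b),
       QRHL.qRHLFirst (QRHL.Cla a) c₁ c₂ (QRHL.Cla b),
       QRHL.qRHLUniform (QRHL.Cla a) c₁ c₂ (QRHL.Cla b)] := by
  tfae_have 1 → 4 := QRHL.qRHLUniform_of_pRHL h₁ h₂
  tfae_have 4 → 3 := QRHL.qRHLFirst_of_qRHLUniform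
  tfae_have 3 → 2 := QRHL.qRHL_of_qRHLFirst
  tfae_have 2 → 1 := QRHL.pRHL_of_qRHL h₁ h₂
  tfae_finish
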